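/- Let $\alpha,\beta>0$ be real numbers such that $\beta/\alpha$ is not an integer, let $\mathbb T=\mathbb R/2\pi\mathbb Z$, $\langle x\rangle=(1+|x|^2)^{1/2}$, and for $u$ on $\mathbb R\times\mathbb T$ put $$\widehat u_k(t)=\int_{\mathbb T}e^{-ikx}u(t,x)\,dx,\qquad \tilde u(k,\tau)=\int_{\mathbb R}e^{-i\tau t}\,\widehat u_k(t)\,dt ,\qquad u(t,x)=\frac1{2\pi}\sum_{k\in\mathbb Z}\widehat u_k(t)e^{ikx}.$$ Write $\|a\|_{\ell^2_k}=\big(\frac1{2\pi}\sum_{k\in\mathbb Z}|a_k|^2\big)^{1/2}$, $\sigma_S=\tau-\alpha k^2$, $\sigma_W=|\tau|-\beta|k|$, and for $s\in\mathbb R$ and $\ast\in\{S,W\}$ let $$\|u\|_{Y^s_\ast}=\big\|\langle k\rangle^s\langle\sigma_\ast\rangle^{1/2}\tilde u\big\|_{\ell^2_kL^2_\tau}+\big\|\langle k\rangle^s\tilde u\big\|_{\ell^2_kL^1_\tau},\qquad \|u\|_{Z^s_\ast}=\big\|\langle k\rangle^s\langle\sigma_\ast\rangle^{-1/2}\tilde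 u\big\|_{\ell^2_kL^2_\tau}+\big\|\langle k\rangle^s\langle\sigma_\ast\rangle^{-1}\tilde u\big\|_{\ell^2_kL^1_\tau}.$$ For a dyadic number $N\in\{1,2,4,8,\dots\}$ let $\widehat{P_Nu}_k=1_{N\le|k|<2N}\,\widehat u_k$. For $C>0$, call $(k_0,k_1,k_2)\in\mathbb Z^3$ resonant (with constant $C$) if $|k_i|\le C|k_j|$ for all $i,j\in\{0,1,2\}$ with $i\ne j$, and nonresonant otherwise. Then there is $\delta_0>0$ such that for every $C>2$ and every $0<\delta\le\delta_0$ there is a constant $K>0$ (depending only on $\alpha,\beta,C,\delta$) such that the following two estimates hold for all dyadic numbers $N_0,N_1,N_2$, with $N_{max}=\max\{N_0,N_1,N_2\}$. (1) If every triple of integers with $k_0=k_1+k_2$ and $N_i\le|k_i|<2N_i$ $(i=0,1,2)$ is nonresonant with constant $C$, then for all $u\in Y^0_S$ and $v\in Y^{-1/2}_W$ $$\big\|P_{N_0}\big(P_{N_1}u\;P_{N_2}v\big)\big\|_{Z^0_S}\le K\,N_{max}^{-\delta}\,\|u\|_{Y^0_S}\,\|v\|_{Y^{-1/2}_W}.$$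 (2) If every triple of integers with $k_0=k_1-k_2$ and $N_i\le|k_i|<2N_i$ $(i=0,1,2)$ is nonresonant with constant $C$, then for all $u,v\in Y^0_S$ $$\big\|P_{N_0}\,\partial_x\big(P_{N_1}u\;\overline{P_{N_2}v}\big)\big\|_{Z^{-1/2}_W}\le K\,N_{max}^{-\delta}\,\|u\|_{Y^0_S}\,\|v\|_{Y^0_S}.$$ -/

import Mathlib

open MeasureTheory
open scoped ENNReal FourierTransform ComplexConjugate

namespace Zakharov

noncomputable section

/-- The bracket `⟨x⟩ = (1 + |x|²)^{1/2}`. -/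
def bracket (x : ℝ) : ℝ := Real.sqrt (1 + x ^ 2)

/-- The `ℓ²_k` norm on `ℤ` for the normalized counting measure `(1/2π) ∑_k`, valued in `[0, ∞]`. -/
def ell2 (a : ℤ → ℝ≥0∞) : ℝ≥0∞ :=
  (ENNReal.ofReal (1 / (2 * Real.pi)) * ∑' k : ℤ, a k ^ (2 : ℝ)) ^ (1 / 2 : ℝ)

/-! ### Functions and distributions on `ℝ × 𝕋`, `𝕋 = ℝ / 2πℤ` -/

/-- A distribution `u(t,x) = (1/2π) ∑_k û_k(t) e^{ikx}` on `ℝ × 𝕋` whose spatial Fourier coefficients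
`û_k` are square integrable in time; there is no condition on the growth in `k`.
Every distribution whose space-time Fourier transform is a function with a finite `X^{s,b}` norm,
`b ≥ 0`, is of this form; in particular every element of the spaces `Y_S^s` and `Y_W^s` is. -/
abbrev SpaceTime : Type := ℤ → Lp ℂ 2 (volume : Measure ℝ)

/-- The space-time Fourier transform `ũ(k,τ) = ∫ e^{-iτt} û_k(t) dt` of `u`, where the integral is
the `L²` Fourier transform (Mathlib's `𝓕` has the kernel `e^{-2πi tξ}`, hence `ξ = τ/2π`). -/
def SpaceTime.fourier (u : SpaceTime) (k : ℤ) (τ : ℝ) : ℂ :=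
  (𝓕 (u k) : Lp ℂ 2 (volume : Measure ℝ)) (τ / (2 * Real.pi))

/-- The spatial Fourier coefficients `û_k(t)` of `u`, as functions of time. -/
def SpaceTime.coeff (u : SpaceTime) (k : ℤ) (t : ℝ) : ℂ := u k t

/-- The spatial Fourier coefficients `∫_𝕋 e^{-ikx} F(t,x) dx` of a function `F(t,x)` that is
`2π`-periodic in `x`. -/
def spatialCoeff (F : ℝ → ℝ → ℂ) (k : ℤ) (t : ℝ) : ℂ :=
  ∫ x in (0 : ℝ)..(2 * Real.pi), Complex.exp (-(Complex.I * k * x)) * F t x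

/-- The space-time Fourier transform `∬_{ℝ × 𝕋} e^{-ikx} e^{-iτt} F(t,x) dx dt` of a function. -/
def spaceTimeFourier (F : ℝ → ℝ → ℂ) (k : ℤ) (τ : ℝ) : ℂ :=
  ∫ t : ℝ, Complex.exp (-(Complex.I * τ * t)) * spatialCoeff F k t

/-- The frequencies `k` with `N ≤ |k| < 2N`. -/
def block (N : ℕ) : Finset ℤ :=
  (Finset.Ioo (-(2 * N : ℤ)) (2 * N)).filter fun k => (N : ℤ) ≤ |k|

/-- The Littlewood-Paley piece `P_N u(t,x) = (1/2π) ∑_{N ≤ |k| < 2N} û_k(t) e^{ikx}`, for given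
spatial Fourier coefficients `û_k(t)`. -/
def littlewoodPaley (N : ℕ) (c : ℤ → ℝ → ℂ) (t x : ℝ) : ℂ :=
  1 / (2 * Real.pi) * ∑ k ∈ block N, c k t * Complex.exp (Complex.I * k * x)

/-! ### The norms, as functions of the space-time Fourier transform `f(k,τ)` -/

/-- The norm of `X_S^{s,b}`. -/
def normXS (α s b : ℝ) (f : ℤ → ℝ → ℂ) : ℝ≥0∞ :=
  ell2 fun k => eLpNorm
    (fun τ : ℝ => ((bracket k ^ s * bracket (τ - α * k ^ 2) ^ b : ℝ) : ℂ) * f k τ) 2 volume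

/-- The norm of `X_W^{s,b}`. -/
def normXW (β s b : ℝ) (f : ℤ → ℝ → ℂ) : ℝ≥0∞ :=
  ell2 fun k => eLpNorm
    (fun τ : ℝ => ((bracket k ^ s * bracket (|τ| - β * |(k : ℝ)|) ^ b : ℝ) : ℂ) * f k τ) 2 volume

/-- The norm of `Y_S^s`. -/
def normYS (α s : ℝ) (f : ℤ → ℝ → ℂ) : ℝ≥0∞ :=
  normXS α s (1 / 2) f +
    ell2 fun k => eLpNorm (fun τ : ℝ => ((bracket k ^ s : ℝ) : ℂ) * f k τ) 1 volume

/-- The norm of `Y_W^s`. -/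
def normYW (β s : ℝ) (f : ℤ → ℝ → ℂ) : ℝ≥0∞ :=
  normXW β s (1 / 2) f +
    ell2 fun k => eLpNorm (fun τ : ℝ => ((bracket k ^ s : ℝ) : ℂ) * f k τ) 1 volume

/-- The norm of `Z_S^s`. -/
def normZS (α s : ℝ) (f : ℤ → ℝ → ℂ) : ℝ≥0∞ :=
  normXS α s (-1 / 2) f +
    ell2 fun k => eLpNorm
      (fun τ : ℝ => ((bracket k ^ s / bracket (τ - α * k ^ 2) : ℝ) : ℂ) * f k τ) 1 volume

/-- The norm of `Z_W^s`. -/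
def normZW (β s : ℝ) (f : ℤ → ℝ → ℂ) : ℝ≥0∞ :=
  normXW β s (-1 / 2) f +
    ell2 fun k => eLpNorm
      (fun τ : ℝ => ((bracket k ^ s / bracket (|τ| - β * |(k : ℝ)|) : ℝ) : ℂ) * f k τ) 1 volume

/-! ### Frequency interactions -/

/-- `N` is a dyadic number `2^j`, `j ≥ 0` (for `N < 1` no integer satisfies `N ≤ |k| < 2N`). -/
def IsDyadic (N : ℕ) : Prop := ∃ j : ℕ, N = 2 ^ j

/-- `|a| ∼ |b|` with the comparability constant `C`. -/
def Comparable (C : ℝ) (a b : ℤ) : Prop :=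
  |(a : ℝ)| ≤ C * |(b : ℝ)| ∧ |(b : ℝ)| ≤ C * |(a : ℝ)|

/-- The resonant set `k₀ ∼ k₁ ∼ k₂`, with the comparability constant `C`. -/
def resonantSet (C : ℝ) : Set (ℤ × ℤ × ℤ) :=
  {k | Comparable C k.1 k.2.1 ∧ Comparable C k.2.1 k.2.2 ∧ Comparable C k.1 k.2.2}

/-- The nonresonant set: the complement of the resonant set. -/
def nonresonantSet (C : ℝ) : Set (ℤ × ℤ × ℤ) := (resonantSet C)ᶜ

/-- All interactions `k₁ + k₂ = k₀` of frequencies `N_i ≤ |k_i| < 2N_i` are nonresonant. -/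
def NonresonantSum (C : ℝ) (N₀ N₁ N₂ : ℕ) : Prop :=
  ∀ k₀ ∈ block N₀, ∀ k₁ ∈ block N₁, ∀ k₂ ∈ block N₂,
    k₀ = k₁ + k₂ → (k₀, k₁, k₂) ∈ nonresonantSet C

/-- All interactions `k₁ - k₂ = k₀` of frequencies `N_i ≤ |k_i| < 2N_i` are nonresonant. -/
def NonresonantDiff (C : ℝ) (N₀ N₁ N₂ : ℕ) : Prop :=
  ∀ k₀ ∈ block N₀, ∀ k₁ ∈ block N₁, ∀ k₂ ∈ block N₂,
    k₀ = k₁ - k₂ → (k₀, k₁, k₂) ∈ nonresonantSet C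

/-! ### The localized nonlinearities -/

/-- `P_{N₀}(P_{N₁}u · P_{N₂}v)`. -/
def schrodingerTerm (N₀ N₁ N₂ : ℕ) (u v : SpaceTime) : ℝ → ℝ → ℂ :=
  littlewoodPaley N₀ (spatialCoeff fun t x =>
    littlewoodPaley N₁ u.coeff t x * littlewoodPaley N₂ v.coeff t x)

/-- `P_{N₀} ∂ₓ(P_{N₁}u · conj (P_{N₂}v))`. -/
def waveTerm (N₀ N₁ N₂ : ℕ) (u v : SpaceTime) : ℝ → ℝ → ℂ :=
  littlewoodPaley N₀ (spatialCoeff fun t x =>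
    deriv (fun y : ℝ => littlewoodPaley N₁ u.coeff t y * conj (littlewoodPaley N₂ v.coeff t y)) x)

end

end Zakharov

open Zakharov

/-!
For `|k|, |l| ≤ M`, a signed sum of the three modulations is the resonance function
`(k - l) (α(k + l) ∓ β)`, which in the nonresonant region has size `|k - l| M` because
`β / α ∉ ℤ`. The `7/16` power of the largest modulation therefore gains `M^{3/8} ⟨k - l⟩^{1/2}`,
where the second factor pays for the half derivative on the wave. By duality and Cauchy-Schwarz,
what remains costs the `L²` norm of a product of the weights `⟨σ⟩^{-7/16}` of the other two
modulations. Their zeros at frequencies `k` and `j` are separated like `|k - j|`, so that this norm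
is `O(M^{1/4})`, which leaves the gain `M^{-1/8}`. Since `7/16 < 1/2`, the weight `⟨σ⟩^{7/16 - 1}`
is in `L²_τ`, so that the `L¹_τ` part of the output norm is controlled in the same way.
-/

namespace Zakharov

section Weights

lemma one_le_bracket (x : ℝ) : 1 ≤ bracket x :=
  Real.one_le_sqrt.2 (by nlinarith [sq_nonneg x])

lemma bracket_pos (x : ℝ) : 0 < bracket x := one_pos.trans_le (one_le_bracket x)

lemma bracket_rpow_nonneg (r x : ℝ) : 0 ≤ bracket x ^ r := Real.rpow_nonneg (bracket_pos x).le r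

lemma bracket_sq (x : ℝ) : bracket x ^ 2 = 1 + x ^ 2 := Real.sq_sqrt (by positivity)

lemma bracket_neg (x : ℝ) : bracket (-x) = bracket x := by simp [bracket]

lemma bracket_abs (x : ℝ) : bracket |x| = bracket x := by simp [bracket]

lemma abs_le_bracket (x : ℝ) : |x| ≤ bracket x := Real.abs_le_sqrt (by linarith)

lemma one_add_abs_le_two_mul_bracket (x : ℝ) : 1 + |x| ≤ 2 * bracket x := by
  linarith [one_le_bracket x, abs_le_bracket x]

lemma bracket_le_two_mul_abs {x : ℝ} (hx : 1 ≤ |x|) : bracket x ≤ 2 * |x| := by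
  rw [bracket, Real.sqrt_le_left (by positivity)]
  nlinarith [sq_abs x]

lemma bracket_add_le (x y : ℝ) : bracket (x + y) ≤ bracket x + bracket y := by
  have hxy : x * y ≤ bracket x * bracket y := by
    calc x * y ≤ |x| * |y| := by rw [← abs_mul]; exact le_abs_self _
      _ ≤ bracket x * bracket y :=
        mul_le_mul (abs_le_bracket x) (abs_le_bracket y) (abs_nonneg y) (bracket_pos x).le
  rw [bracket, Real.sqrt_le_left (add_pos (bracket_pos x) (bracket_pos y)).le]
  nlinarith [bracket_sq x, bracket_sq y]

lemma continuous_bracket : Continuous bracket := by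
  unfold bracket
  fun_prop

/-- The weight `⟨x⟩^r`, valued in `[0, ∞]`. -/
noncomputable def weight (r x : ℝ) : ℝ≥0∞ := ENNReal.ofReal (bracket x ^ r)

lemma weight_eq_rpow (r x : ℝ) : weight r x = ENNReal.ofReal (bracket x) ^ r := by
  rw [weight, ENNReal.ofReal_rpow_of_pos (bracket_pos x)]

@[fun_prop]
lemma measurable_weight (r : ℝ) : Measurable (weight r) :=
  (continuous_bracket.measurable.pow_const r).ennreal_ofReal

lemma weight_mul_weight (r s x : ℝ) : weight r x * weight s x = weight (r + s) x := by
  rw [weight, weight, weight, ← ENNReal.ofReal_mul (bracket_rpow_nonneg r x),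
    Real.rpow_add (bracket_pos x)]

lemma weight_zero (x : ℝ) : weight 0 x = 1 := by simp [weight]

lemma weight_sq (r x : ℝ) : weight r x ^ 2 = weight (2 * r) x := by
  rw [sq, weight_mul_weight, two_mul]

lemma weight_mul_weight_neg (r x : ℝ) : weight r x * weight (-r) x = 1 := by
  rw [weight_mul_weight, add_neg_cancel, weight_zero]

lemma weight_mono {r s : ℝ} (h : r ≤ s) (x : ℝ) : weight r x ≤ weight s x :=
  ENNReal.ofReal_le_ofReal (Real.rpow_le_rpow_of_exponent_le (one_le_bracket x) h)

lemma weight_abs (r x : ℝ) : weight r |x| = weight r x := by simp [weight, bracket_abs]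

lemma weight_sub_comm (r x y : ℝ) : weight r (x - y) = weight r (y - x) := by
  rw [weight, weight, ← neg_sub, bracket_neg]

lemma bracket_rpow_neg_le {r : ℝ} (hr : 0 ≤ r) (x : ℝ) :
    bracket x ^ (-r) ≤ 2 ^ r * (1 + |x|) ^ (-r) := by
  have h : (2 * bracket x) ^ (-r) ≤ (1 + |x|) ^ (-r) :=
    Real.rpow_le_rpow_of_nonpos (by positivity) (one_add_abs_le_two_mul_bracket x) (by linarith)
  rwa [Real.mul_rpow zero_le_two (bracket_pos x).le, Real.rpow_neg zero_le_two,
    inv_mul_le_iff₀ (by positivity)] at h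

lemma lintegral_weight_lt_top {r : ℝ} (hr : 1 < r) : ∫⁻ x, weight (-r) x < ∞ := by
  have h := finite_integral_one_add_norm (E := ℝ) (μ := volume) (r := r) (by simpa using hr)
  calc ∫⁻ x, weight (-r) x
      ≤ ∫⁻ x, ENNReal.ofReal (2 ^ r) * ENNReal.ofReal ((1 + ‖x‖) ^ (-r)) :=
        lintegral_mono fun x => by
          rw [← ENNReal.ofReal_mul (by positivity)]
          exact ENNReal.ofReal_le_ofReal (bracket_rpow_neg_le (by linarith) x)
    _ < ∞ := by
        rw [lintegral_const_mul _ (by fun_prop)]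
        exact ENNReal.mul_lt_top ENNReal.ofReal_lt_top h

lemma rpow_neg_mul_rpow_neg_le_of_le_add {a b d p q : ℝ} (ha : 0 < a) (hb : 0 < b) (hd : 0 < d)
    (h : d ≤ a + b) (hq : 0 ≤ q) (hqp : q ≤ p) :
    a ^ (-p) * b ^ (-p) ≤ 2 ^ q * d ^ (-q) * (a ^ (-(2 * p - q)) + b ^ (-(2 * p - q))) := by
  wlog hab : b ≤ a generalizing a b
  · have := this hb ha (by linarith) (by linarith)
    rwa [mul_comm (a ^ _), add_comm (a ^ _)]
  have a_le : a ^ (-q) ≤ 2 ^ q * d ^ (-q) := by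
    have := Real.rpow_le_rpow_of_nonpos (z := -q) (by positivity) (show d / 2 ≤ a by linarith)
      (by linarith)
    rwa [Real.div_rpow hd.le zero_le_two, Real.rpow_neg zero_le_two, div_inv_eq_mul,
      mul_comm] at this
  calc a ^ (-p) * b ^ (-p)
      = a ^ (-q) * (a ^ (-(p - q)) * b ^ (-p)) := by
        rw [← mul_assoc, ← Real.rpow_add ha]; ring_nf
    _ ≤ a ^ (-q) * (b ^ (-(p - q)) * b ^ (-p)) := by
        gcongr ?_ * (?_ * ?_)
        exact Real.rpow_le_rpow_of_nonpos hb hab (by linarith)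
    _ = a ^ (-q) * b ^ (-(2 * p - q)) := by rw [← Real.rpow_add hb]; ring_nf
    _ ≤ (2 ^ q * d ^ (-q)) * (a ^ (-(2 * p - q)) + b ^ (-(2 * p - q))) := by
        gcongr
        exact le_add_of_nonneg_left (by positivity)

theorem lintegral_weight_mul_weight_le {p q : ℝ} (hq : 0 ≤ q) (hqp : q ≤ p) (a b : ℝ) :
    ∫⁻ τ, weight (-p) (τ - a) * weight (-p) (τ - b) ≤
      2 * ENNReal.ofReal (2 ^ q) * (∫⁻ x, weight (-(2 * p - q)) x) * weight (-q) (a - b) := by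
  have pointwise (τ : ℝ) : weight (-p) (τ - a) * weight (-p) (τ - b) ≤
      ENNReal.ofReal (2 ^ q) * weight (-q) (a - b) *
        (weight (-(2 * p - q)) (τ - a) + weight (-(2 * p - q)) (τ - b)) := by
    have triangle : bracket (a - b) ≤ bracket (τ - a) + bracket (τ - b) := by
      have := bracket_add_le (-(τ - a)) (τ - b)
      rwa [bracket_neg, neg_sub, sub_add_sub_cancel] at this
    simp only [weight]
    rw [← ENNReal.ofReal_mul (bracket_rpow_nonneg _ _),
      ← ENNReal.ofReal_add (bracket_rpow_nonneg _ _) (bracket_rpow_nonneg _ _),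
      ← ENNReal.ofReal_mul (by positivity),
      ← ENNReal.ofReal_mul (mul_nonneg (by positivity) (bracket_rpow_nonneg _ _))]
    exact ENNReal.ofReal_le_ofReal (rpow_neg_mul_rpow_neg_le_of_le_add (bracket_pos _)
      (bracket_pos _) (bracket_pos _) triangle hq hqp)
  calc _ ≤ _ := lintegral_mono pointwise
    _ = _ := by
      rw [lintegral_const_mul _ (by fun_prop), lintegral_add_left (by fun_prop),
        lintegral_sub_right_eq_self (weight _), lintegral_sub_right_eq_self (weight _)]
      ring

lemma summable_one_add_abs_int_rpow {r : ℝ} (hr : 1 < r) :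
    Summable fun m : ℤ => (1 + |(m : ℝ)|) ^ (-r) := by
  refine Summable.of_norm_bounded_eventually
    (g := fun m : ℤ => |(m : ℝ)| ^ (-r)) (Real.summable_abs_int_rpow hr) ?_
  filter_upwards [(Set.finite_singleton (0 : ℤ)).compl_mem_cofinite] with m hm
  have : 0 < |(m : ℝ)| := abs_pos.2 (Int.cast_ne_zero.2 hm)
  rw [Real.norm_of_nonneg (by positivity)]
  exact Real.rpow_le_rpow_of_nonpos this (by linarith) (by linarith)

lemma mul_one_add_abs_le_bracket {c x m : ℝ} (hm : c * |m| ≤ 2 * |x|) :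
    min (1 / 2) (c / 4) * (1 + |m|) ≤ bracket x := by
  have one_half : min (1 / 2) (c / 4) ≤ 1 / 2 := min_le_left _ _
  have c_div : min (1 / 2) (c / 4) * |m| ≤ c / 4 * |m| := by gcongr; exact min_le_right _ _
  linarith [one_le_bracket x, abs_le_bracket x]

lemma exists_bracket_rpow_le_of_separated {c : ℝ} (hc : 0 < c) {q : ℝ} (hq : 0 ≤ q)
    {B : Finset ℤ} (hB : B.Nonempty) {a : ℤ → ℝ}
    (ha : ∀ k ∈ B, ∀ j ∈ B, c * |(k - j : ℝ)| ≤ |a k - a j|) :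
    ∃ l ∈ B, ∀ k ∈ B,
      bracket (a k) ^ (-q) ≤ min (1 / 2) (c / 4) ^ (-q) * (1 + |(k - l : ℝ)|) ^ (-q) := by
  obtain ⟨l, hl, hmin⟩ := B.exists_min_image (fun k => |a k|) hB
  refine ⟨l, hl, fun k hk => ?_⟩
  have : c * |(k - l : ℝ)| ≤ 2 * |a k| := by
    linarith [ha k hk l hl, hmin k hk, abs_sub (a k) (a l)]
  rw [← Real.mul_rpow (by positivity) (by positivity)]
  exact Real.rpow_le_rpow_of_nonpos (by positivity) (mul_one_add_abs_le_bracket this) (by linarith)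

lemma sum_one_add_abs_sub_rpow_le_tsum {r : ℝ} (hr : 1 < r) (B : Finset ℤ) (l : ℤ) :
    ∑ k ∈ B, (1 + |(k - l : ℝ)|) ^ (-r) ≤ ∑' m : ℤ, (1 + |(m : ℝ)|) ^ (-r) := by
  rw [← (Equiv.subRight l).tsum_eq]
  simpa only [Function.comp_def, Equiv.subRight_apply, Int.cast_sub] using
    ((Equiv.subRight l).summable_iff.2 (summable_one_add_abs_int_rpow hr)).sum_le_tsum B
      fun k _ => Real.rpow_nonneg (add_nonneg zero_le_one (abs_nonneg _)) _

theorem exists_sum_weight_le_of_separated {c : ℝ} (hc : 0 < c) {q r : ℝ} (hq : 0 ≤ q) (hqr : q ≤ r)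
    (hr : 1 < r) :
    ∃ A : NNReal, ∀ (N : ℕ) (B : Finset ℤ) (a : ℤ → ℝ), 1 ≤ N →
      (∀ k ∈ B, |(k : ℝ)| ≤ N) →
      (∀ k ∈ B, ∀ j ∈ B, c * |(k - j : ℝ)| ≤ |a k - a j|) →
      ∑ k ∈ B, weight (-q) (a k) ≤ A * (N : ℝ≥0∞) ^ (r - q) := by
  set Z := ∑' m : ℤ, (1 + |(m : ℝ)|) ^ (-r)
  set c' := min (1 / 2) (c / 4)
  refine ⟨(c' ^ (-q) * 3 ^ (r - q) * Z).toNNReal, fun N B a hN hB ha => ?_⟩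
  rcases B.eq_empty_or_nonempty with rfl | hne
  · simp
  obtain ⟨l, hl, hterm⟩ := exists_bracket_rpow_le_of_separated hc hq hne ha
  have trade (k) (hk : k ∈ B) :
      (1 + |(k - l : ℝ)|) ^ (-q) ≤ (3 * N) ^ (r - q) * (1 + |(k - l : ℝ)|) ^ (-r) := by
    have hN' : (1 : ℝ) ≤ N := by exact_mod_cast hN
    have : 1 + |(k - l : ℝ)| ≤ 3 * N := by linarith [hB k hk, hB l hl, abs_sub (k : ℝ) l]
    rw [show -q = (r - q) + -r by ring, Real.rpow_add (by positivity)]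
    gcongr
  calc ∑ k ∈ B, weight (-q) (a k)
      = ENNReal.ofReal (∑ k ∈ B, bracket (a k) ^ (-q)) :=
        (ENNReal.ofReal_sum_of_nonneg fun k _ => bracket_rpow_nonneg _ _).symm
    _ ≤ ENNReal.ofReal (∑ k ∈ B, c' ^ (-q) * ((3 * N) ^ (r - q) * (1 + |(k - l : ℝ)|) ^ (-r))) := by
        gcongr with k hk
        refine (hterm k hk).trans ?_
        gcongr
        exact trade k hk
    _ ≤ ENNReal.ofReal (c' ^ (-q) * 3 ^ (r - q) * Z * N ^ (r - q)) := by
        rw [← Finset.mul_sum, ← Finset.mul_sum, Real.mul_rpow (by norm_num) (by positivity)]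
        refine ENNReal.ofReal_le_ofReal ?_
        calc _ = c' ^ (-q) * 3 ^ (r - q) * (∑ k ∈ B, (1 + |(k - l : ℝ)|) ^ (-r)) * N ^ (r - q) := by
              ring
          _ ≤ _ := by
              gcongr
              exact sum_one_add_abs_sub_rpow_le_tsum hr B l
    _ = _ := by
        rw [ENNReal.ofReal_mul' (by positivity), ← ENNReal.ofReal_rpow_of_nonneg N.cast_nonneg
          (by linarith), ENNReal.ofReal_natCast]
        rfl

lemma weight_neg_half_mul_abs_le (x : ℝ) :
    weight (-1 / 2) x * ENNReal.ofReal |x| ≤ weight (1 / 2) x := by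
  rw [weight, weight, ← ENNReal.ofReal_mul (bracket_rpow_nonneg _ x)]
  refine ENNReal.ofReal_le_ofReal ?_
  calc bracket x ^ (-1 / 2 : ℝ) * |x| ≤ bracket x ^ (-1 / 2 : ℝ) * bracket x ^ (1 : ℝ) := by
        rw [Real.rpow_one]
        exact mul_le_mul_of_nonneg_left (abs_le_bracket x) (bracket_rpow_nonneg _ x)
    _ = bracket x ^ (1 / 2 : ℝ) := by
        rw [← Real.rpow_add (bracket_pos x)]
        norm_num

end Weights

section Modulations

/-- The Schrödinger modulation `σ_S = τ - αk²` at the frequency `(k, τ)`. -/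
def modS (α : ℝ) (x : ℤ × ℝ) : ℝ := x.2 - α * (x.1 : ℝ) ^ 2

/-- The wave modulation `σ_W = |τ| - β|k|` at the frequency `(k, τ)`. -/
def modW (β : ℝ) (x : ℤ × ℝ) : ℝ := |x.2| - β * |(x.1 : ℝ)|

@[fun_prop]
lemma measurable_modS (α : ℝ) : Measurable (modS α) := by
  unfold modS
  fun_prop

@[fun_prop]
lemma measurable_modW (β : ℝ) : Measurable (modW β) := by
  unfold modW
  fun_prop

lemma modW_neg (β : ℝ) (x : ℤ × ℝ) : modW β (-x) = modW β x := by simp [modW]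

lemma exists_abs_modW_eq (β : ℝ) (x : ℤ × ℝ) :
    ∃ s : ℝ, |s| = 1 ∧ |modW β x| = |x.2 - s * β * x.1| := by
  unfold modW
  rcases abs_choice x.2 with h | h <;> rcases abs_choice (x.1 : ℝ) with h' | h' <;> rw [h, h']
  · exact ⟨1, by simp, by congr 1; ring⟩
  · exact ⟨-1, by simp, by congr 1; ring⟩
  · exact ⟨-1, by simp, by rw [← abs_neg]; congr 1; ring⟩
  · exact ⟨1, by simp, by rw [← abs_neg]; congr 1; ring⟩

lemma weight_modW_le (r β : ℝ) (x : ℤ × ℝ) :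
    weight r (modW β x) ≤ ∑ s ∈ ({1, -1} : Finset ℝ), weight r (x.2 - s * β * x.1) := by
  obtain ⟨s, hs, h⟩ := exists_abs_modW_eq β x
  rw [← weight_abs, h, weight_abs]
  refine Finset.single_le_sum (f := fun s => weight r (x.2 - s * β * x.1))
    (fun _ _ => zero_le) ?_
  simpa using eq_or_eq_neg_of_abs_eq hs

end Modulations

section Resonance

lemma exists_le_abs_mul_sub_mul {α β : ℝ} (hβα : ∀ m : ℤ, β / α ≠ m) :
    ∃ c > 0, ∀ (m : ℤ) (s : ℝ), |s| = 1 → c * (1 + |(m : ℝ)|) ≤ |α * m - s * β| := by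
  have hα : 0 < |α| := abs_pos.2 fun h => hβα 0 (by simp [h])
  set d := |α| * |β / α - round (β / α)|
  have hd_pos : 0 < d := mul_pos hα (abs_pos.2 (sub_ne_zero.2 (hβα _)))
  have dist_le_of_one (n : ℤ) : d ≤ |α * n - β| := by
    have : α * n - β = -(α * (β / α - n)) := by field_simp [abs_pos.1 hα]; ring
    rw [this, abs_neg, abs_mul]
    exact mul_le_mul_of_nonneg_left (round_le _ _) hα.le
  have dist_le (m : ℤ) (s : ℝ) (hs : |s| = 1) : d ≤ |α * m - s * β| := by
    rcases eq_or_eq_neg_of_abs_eq hs with rfl | rfl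
    · simpa using dist_le_of_one m
    · rw [← abs_neg]
      convert dist_le_of_one (-m) using 2
      push_cast
      ring
  refine ⟨(1 / d + (1 + |β| / d) / |α|)⁻¹, by positivity, fun m s hs => ?_⟩
  have hX := dist_le m s hs
  set X := |α * m - s * β|
  have one_le : 1 ≤ 1 / d * X := by rwa [one_div_mul_eq_div, one_le_div₀ hd_pos]
  have triangle : |α| * |(m : ℝ)| ≤ X + |β| := by
    have := abs_sub_abs_le_abs_sub (α * m) (s * β)
    rw [abs_mul, abs_mul, hs, one_mul] at this
    linarith
  have abs_le : |(m : ℝ)| ≤ (1 + |β| / d) / |α| * X := by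
    rw [div_mul_eq_mul_div, le_div_iff₀ hα]
    calc |(m : ℝ)| * |α| ≤ X + |β| * 1 := by linarith
      _ ≤ X + |β| * (1 / d * X) := by gcongr
      _ = (1 + |β| / d) * X := by ring
  rw [inv_mul_le_iff₀ (by positivity)]
  linarith

lemma sub_mem_resonantSet {C : ℝ} (hC : 2 < C) {k l : ℤ}
    (h : C * |(k + l : ℝ)| ≤ (C - 2) * |(k - l : ℝ)|) : (k - l, k, l) ∈ resonantSet C := by
  have h_add_sub : |(k + l : ℝ)| ≤ |(k - l : ℝ)| := by
    nlinarith [abs_nonneg (k + l : ℝ), abs_nonneg (k - l : ℝ)]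
  have hk_le : |(k : ℝ)| ≤ |(k - l : ℝ)| := by
    have := abs_add_le (k + l : ℝ) (k - l)
    rw [show (k + l + (k - l) : ℝ) = 2 * k by ring, abs_mul, abs_two] at this
    linarith
  have hl_le : |(l : ℝ)| ≤ |(k - l : ℝ)| := by
    have := abs_sub (k + l : ℝ) (k - l)
    rw [show (k + l - (k - l) : ℝ) = 2 * l by ring, abs_mul, abs_two] at this
    linarith
  have le_hk : |(k - l : ℝ)| ≤ C * |(k : ℝ)| := by
    have := abs_sub (2 * k : ℝ) (k + l)
    rw [show (2 * k - (k + l) : ℝ) = k - l by ring, abs_mul, abs_two] at this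
    nlinarith
  have le_hl : |(k - l : ℝ)| ≤ C * |(l : ℝ)| := by
    have := abs_sub (k + l : ℝ) (2 * l)
    rw [show (k + l - 2 * l : ℝ) = k - l by ring, abs_mul, abs_two] at this
    nlinarith
  have le_self : |(k - l : ℝ)| ≤ C * |(k - l : ℝ)| := by nlinarith [abs_nonneg (k - l : ℝ)]
  simp only [resonantSet, Comparable, Set.mem_ofPred_eq, Int.cast_sub]
  exact ⟨⟨le_hk, hk_le.trans le_self⟩, ⟨hk_le.trans le_hl, hl_le.trans le_hk⟩,
    le_hl, hl_le.trans le_self⟩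

lemma comparable_comm {C : ℝ} {a b : ℤ} : Comparable C a b ↔ Comparable C b a := and_comm

lemma mem_nonresonantSet_rotate {C : ℝ} {a b c : ℤ} :
    (a, b, c) ∈ nonresonantSet C ↔ (c, a, b) ∈ nonresonantSet C := by
  simp only [nonresonantSet, resonantSet, Set.mem_compl_iff, Set.mem_ofPred_eq]
  rw [comparable_comm (a := c) (b := a), comparable_comm (a := c) (b := b)]
  tauto

/-- The nonresonant pairs `(k, l)` of Schrödinger frequencies, with wave frequency `k - l ≠ 0`,
for which the largest of `|k|`, `|l|`, `|k - l|` is comparable to `M`. -/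
def nonresonantPairs (C : ℝ) (M : ℕ) : Set (ℤ × ℤ) :=
  {p | p.1 ≠ p.2 ∧ |p.1| ≤ M ∧ |p.2| ≤ M ∧ M ≤ 2 * max |p.1| (max |p.2| |p.1 - p.2|) ∧
    (p.1 - p.2, p.1, p.2) ∈ nonresonantSet C}

lemma le_abs_add_of_mem_nonresonantPairs {C : ℝ} (hC : 2 < C) {M : ℕ} {k l : ℤ}
    (h : (k, l) ∈ nonresonantPairs C M) : (C - 2) * M ≤ 2 * C * |(k + l : ℝ)| := by
  obtain ⟨-, -, -, hM, hnr⟩ := h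
  have sub_le : (C - 2) * |(k - l : ℝ)| ≤ C * |(k + l : ℝ)| := by
    by_contra! hlt
    exact hnr (sub_mem_resonantSet hC hlt.le)
  have k_le : 2 * |(k : ℝ)| ≤ |(k + l : ℝ)| + |(k - l : ℝ)| := by
    have := abs_add_le (k + l : ℝ) (k - l)
    rwa [show (k + l + (k - l) : ℝ) = 2 * k by ring, abs_mul, abs_two] at this
  have l_le : 2 * |(l : ℝ)| ≤ |(k + l : ℝ)| + |(k - l : ℝ)| := by
    have := abs_sub (k + l : ℝ) (k - l)
    rwa [show (k + l - (k - l) : ℝ) = 2 * l by ring, abs_mul, abs_two] at this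
  have max_le : (C - 2) * max |(k : ℝ)| (max |(l : ℝ)| |(k - l : ℝ)|) ≤ C * |(k + l : ℝ)| := by
    have add_nonneg := abs_nonneg (k + l : ℝ)
    rcases max_choice |(k : ℝ)| (max |(l : ℝ)| |(k - l : ℝ)|) with h | h <;> rw [h]
    · nlinarith
    · rcases max_choice |(l : ℝ)| |(k - l : ℝ)| with h | h <;> rw [h] <;> nlinarith
  have hM' : (M : ℝ) ≤ 2 * max |(k : ℝ)| (max |(l : ℝ)| |(k - l : ℝ)|) := by exact_mod_cast hM
  nlinarith

/-- The resonance identity `(k - l) (α(k + l) ∓ β) = -σ_S(x) + σ_S(y) + (τ ∓ β(k - l))`, for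
`x - y = (k - l, τ)`, forces one of the three modulations to be large. -/
theorem exists_le_bracket_add_bracket_add_bracket {α β : ℝ} (hβα : ∀ m : ℤ, β / α ≠ m) {C : ℝ}
    (hC : 2 < C) :
    ∃ c > 0, ∀ (M : ℕ) (x y : ℤ × ℝ), (x.1, y.1) ∈ nonresonantPairs C M →
      c * (|(x.1 - y.1 : ℝ)| * M) ≤
        bracket (modS α x) + bracket (modS α y) + bracket (modW β (x - y)) := by
  obtain ⟨c, hc, gap⟩ := exists_le_abs_mul_sub_mul hβα
  refine ⟨c * ((C - 2) / (2 * C)), mul_pos hc (div_pos (by linarith) (by linarith)),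
    fun M x y hxy => ?_⟩
  obtain ⟨s, hs, hW⟩ := exists_abs_modW_eq β (x - y)
  have M_le : (C - 2) / (2 * C) * M ≤ 1 + |((x.1 + y.1 : ℤ) : ℝ)| := by
    have := le_abs_add_of_mem_nonresonantPairs hC hxy
    push_cast
    rw [div_mul_eq_mul_div, div_le_iff₀ (by linarith)]
    linarith
  calc c * ((C - 2) / (2 * C)) * (|(x.1 - y.1 : ℝ)| * M)
      = |(x.1 - y.1 : ℝ)| * (c * ((C - 2) / (2 * C) * M)) := by ring
    _ ≤ |(x.1 - y.1 : ℝ)| * |α * (x.1 + y.1 : ℤ) - s * β| := by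
        gcongr
        exact (mul_le_mul_of_nonneg_left M_le hc.le).trans (gap _ s hs)
    _ = |-modS α x + modS α y + ((x - y).2 - s * β * (x - y).1)| := by
        rw [← abs_mul, modS, modS, Prod.snd_sub, Prod.fst_sub]
        push_cast
        ring_nf
    _ ≤ |modS α x| + |modS α y| + |modW β (x - y)| := by
        rw [hW, ← abs_neg (modS α x)]
        exact abs_add_three _ _ _
    _ ≤ _ := by gcongr <;> exact abs_le_bracket _

end Resonance

section ENormL2

variable {X : Type*} [MeasurableSpace X] {μ : Measure X}

lemma eLpNorm_two_sq (f : X → ℝ≥0∞) : eLpNorm f 2 μ ^ 2 = ∫⁻ x, f x ^ 2 ∂μ := by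
  rw [← ENNReal.rpow_natCast, Nat.cast_ofNat]
  simpa using eLpNorm_nnreal_pow_eq_lintegral (p := 2) (f := f) (μ := μ) two_ne_zero

lemma eLpNorm_two_le_of_sq_le {f : X → ℝ≥0∞} {S : ℝ≥0∞} (h : ∫⁻ x, f x ^ 2 ∂μ ≤ S ^ 2) :
    eLpNorm f 2 μ ≤ S := by
  rwa [← eLpNorm_two_sq, ENNReal.pow_le_pow_left_iff two_ne_zero] at h

lemma lintegral_mul_le_eLpNorm_two {f g : X → ℝ≥0∞} (hf : Measurable f) (hg : Measurable g) :
    ∫⁻ x, f x * g x ∂μ ≤ eLpNorm f 2 μ * eLpNorm g 2 μ := by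
  have h := ENNReal.lintegral_mul_le_Lp_mul_Lq μ Real.HolderConjugate.two_two hf.aemeasurable
    hg.aemeasurable
  simpa [eLpNorm_eq_lintegral_rpow_enorm_toReal] using h

/- Testing on `√g`, where `g ≤ F ^ 2` is simple with finite integral, avoids dividing by
`‖F‖ = ∞`. -/
lemma eLpNorm_two_le_of_forall_lintegral_mul_le [SigmaFinite μ] {F : X → ℝ≥0∞} {A : ℝ≥0∞}
    (h : ∀ f : X → ℝ≥0∞, Measurable f → ∫⁻ x, f x * F x ∂μ ≤ A * eLpNorm f 2 μ) :
    eLpNorm F 2 μ ≤ A := by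
  refine eLpNorm_two_le_of_sq_le ?_
  by_contra! hlt
  obtain ⟨g₀, hg₀, hlt₀⟩ : ∃ g₀ : SimpleFunc X NNReal, (∀ x, (g₀ x : ℝ≥0∞) ≤ F x ^ 2) ∧
      A ^ 2 < ∫⁻ x, g₀ x ∂μ := by
    simp_rw [lintegral_eq_nnreal, lt_iSup_iff] at hlt
    obtain ⟨g₀, hg₀, hlt₀⟩ := hlt
    exact ⟨g₀, hg₀, by simpa [← SimpleFunc.lintegral_eq_lintegral] using hlt₀⟩
  obtain ⟨g, hg, hg_fin, hg_lt⟩ := g₀.exists_lt_lintegral_simpleFunc_of_lt_lintegral hlt₀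
  set f : X → ℝ≥0∞ := fun x => NNReal.sqrt (g x)
  have f_sq (x : X) : f x ^ 2 = g x := by
    simp [f, ← ENNReal.coe_pow]
  have f_le (x : X) : f x ≤ F x := by
    rw [← ENNReal.pow_le_pow_left_iff two_ne_zero, f_sq]
    exact (ENNReal.coe_le_coe.2 (hg x)).trans (hg₀ x)
  have norm_sq : eLpNorm f 2 μ ^ 2 = ∫⁻ x, g x ∂μ := by
    simp only [eLpNorm_two_sq, f_sq]
  rw [← norm_sq] at hg_fin hg_lt
  have le_A : eLpNorm f 2 μ * eLpNorm f 2 μ ≤ A * eLpNorm f 2 μ := by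
    rw [← sq, eLpNorm_two_sq]
    refine (lintegral_mono fun x => ?_).trans (h f (by fun_prop))
    rw [sq]
    exact mul_le_mul_right (f_le x) _
  refine hg_lt.not_ge (pow_le_pow_left₀ zero_le ?_ 2)
  refine (ENNReal.mul_le_mul_iff_left ?_ ?_).1 le_A
  · rintro h0
    simp [h0] at hg_lt
  · rintro h0
    simp [h0] at hg_fin

lemma eLpNorm_two_mul_indicator_le [SigmaFinite μ] {w w' J : X → ℝ≥0∞} {S : Set X}
    {A : ℝ≥0∞} (hS : MeasurableSet S) (hw' : Measurable w') (hw : ∀ x, w x * w' x = 1)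
    (h : ∀ f : X → ℝ≥0∞, Measurable f → (∀ x, f x ≠ 0 → x ∈ S) →
      ∫⁻ x, f x * J x ∂μ ≤ A * eLpNorm (fun x => w x * f x) 2 μ) :
    eLpNorm (fun x => w' x * S.indicator J x) 2 μ ≤ A := by
  refine eLpNorm_two_le_of_forall_lintegral_mul_le fun f hf => ?_
  calc ∫⁻ x, f x * (w' x * S.indicator J x) ∂μ
      = ∫⁻ x, S.indicator (fun x => w' x * f x) x * J x ∂μ :=
        lintegral_congr fun x => by by_cases hx : x ∈ S <;> simp [hx]; ring
    _ ≤ A * eLpNorm (fun x => w x * S.indicator (fun x => w' x * f x) x) 2 μ :=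
        h _ ((hw'.mul hf).indicator hS) fun x hx => Set.mem_of_indicator_ne_zero hx
    _ ≤ A * eLpNorm f 2 μ := by
        refine mul_le_mul_right (eLpNorm_mono_enorm fun x => ?_) A
        by_cases hx : x ∈ S <;> simp [hx, ← mul_assoc, hw]

end ENormL2

section BilinearCauchySchwarz

variable {X Y : Type*} [MeasurableSpace X] [MeasurableSpace Y] {μ : Measure X} {ν : Measure Y}
  [SFinite ν]

lemma eLpNorm_two_prod_mul {f : X → ℝ≥0∞} {g : Y → ℝ≥0∞} (hf : Measurable f) (hg : Measurable g) :
    eLpNorm (fun p : X × Y => f p.1 * g p.2) 2 (μ.prod ν) = eLpNorm f 2 μ * eLpNorm g 2 ν := by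
  refine (ENNReal.pow_right_strictMono (n := 2) two_ne_zero).injective ?_
  simp only [mul_pow, eLpNorm_two_sq]
  exact lintegral_prod_mul (hf.pow_const 2).aemeasurable (hg.pow_const 2).aemeasurable

lemma eLpNorm_two_prod_kernel_le {f : X → ℝ≥0∞} {K : X → Y → ℝ≥0∞} (hf : Measurable f)
    (hK : Measurable K.uncurry) {S : ℝ≥0∞} (hS : ∀ x, eLpNorm (K x) 2 ν ≤ S) :
    eLpNorm (fun p : X × Y => f p.1 * K p.1 p.2) 2 (μ.prod ν) ≤ S * eLpNorm f 2 μ := by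
  have hK' : Measurable fun p : X × Y => K p.1 p.2 := hK
  refine eLpNorm_two_le_of_sq_le ?_
  rw [lintegral_prod _ (by fun_prop)]
  calc ∫⁻ x, ∫⁻ y, (f x * K x y) ^ 2 ∂ν ∂μ = ∫⁻ x, f x ^ 2 * eLpNorm (K x) 2 ν ^ 2 ∂μ := by
        refine lintegral_congr fun x => ?_
        simp only [mul_pow]
        rw [lintegral_const_mul _ (by fun_prop), eLpNorm_two_sq]
    _ ≤ ∫⁻ x, S ^ 2 * f x ^ 2 ∂μ := by
        refine lintegral_mono fun x => ?_
        rw [mul_comm (S ^ 2)]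
        gcongr
        exact hS x
    _ = (S * eLpNorm f 2 μ) ^ 2 := by
        rw [lintegral_const_mul _ (by fun_prop), mul_pow, eLpNorm_two_sq]

lemma lintegral_prod_kernel_mul_le {f : X → ℝ≥0∞} {K : X → Y → ℝ≥0∞} {F : X × Y → ℝ≥0∞}
    (hf : Measurable f) (hK : Measurable K.uncurry) (hF : Measurable F) {S : ℝ≥0∞}
    (hS : ∀ x, eLpNorm (K x) 2 ν ≤ S) :
    ∫⁻ p : X × Y, f p.1 * K p.1 p.2 * F p ∂(μ.prod ν) ≤
      S * eLpNorm f 2 μ * eLpNorm F 2 (μ.prod ν) := by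
  have hK' : Measurable fun p : X × Y => K p.1 p.2 := hK
  calc _ ≤ _ := lintegral_mul_le_eLpNorm_two (by fun_prop) hF
    _ ≤ _ := by
      gcongr
      exact eLpNorm_two_prod_kernel_le hf hK hS

end BilinearCauchySchwarz

section TrilinearKernel

variable {G : Type*} [AddCommGroup G] [MeasurableSpace G] [MeasurableAdd₂ G] [MeasurableNeg G]
  {μ : Measure G} [SFinite μ] [μ.IsAddLeftInvariant] {f g h : G → ℝ≥0∞} {K : G → G → ℝ≥0∞}
  {S : ℝ≥0∞}

lemma lintegral_trilinear_kernel_fst_le (hf : Measurable f) (hg : Measurable g) (hh : Measurable h)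
    (hK : Measurable K.uncurry) (hS : ∀ x, eLpNorm (K x) 2 μ ≤ S) :
    ∫⁻ p : G × G, f p.1 * g p.2 * h (p.1 - p.2) * K p.1 p.2 ∂(μ.prod μ) ≤
      S * (eLpNorm f 2 μ * eLpNorm g 2 μ * eLpNorm h 2 μ) := by
  have norm_eq : eLpNorm (fun p : G × G => h (p.1 - p.2) * g p.2) 2 (μ.prod μ) =
      eLpNorm h 2 μ * eLpNorm g 2 μ := by
    rw [← eLpNorm_two_prod_mul hh hg]
    have hm : Measurable fun q : G × G => h q.1 * g q.2 := by fun_prop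
    exact (eLpNorm_comp_measurePreserving hm.aestronglyMeasurable
      (measurePreserving_sub_prod μ μ) :)
  calc _ = ∫⁻ p : G × G, f p.1 * K p.1 p.2 * (h (p.1 - p.2) * g p.2) ∂(μ.prod μ) :=
        lintegral_congr fun p => by ring
    _ ≤ _ := lintegral_prod_kernel_mul_le hf hK (by fun_prop) hS
    _ = _ := by rw [norm_eq]; ring

lemma lintegral_trilinear_kernel_snd_le [μ.IsNegInvariant] (hf : Measurable f) (hg : Measurable g)
    (hh : Measurable h) (hK : Measurable K.uncurry) (hS : ∀ y, eLpNorm (K y) 2 μ ≤ S) :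
    ∫⁻ p : G × G, f p.1 * g p.2 * h (p.1 - p.2) * K p.2 p.1 ∂(μ.prod μ) ≤
      S * (eLpNorm f 2 μ * eLpNorm g 2 μ * eLpNorm h 2 μ) := by
  have hK' : Measurable fun p : G × G => K p.1 p.2 := hK
  have hh' : Measurable fun x => h (-x) := by fun_prop
  have norm_eq : eLpNorm (fun x => h (-x)) 2 μ = eLpNorm h 2 μ :=
    eLpNorm_comp_measurePreserving hh.aestronglyMeasurable (Measure.measurePreserving_neg μ)
  calc _ = ∫⁻ p : G × G, g p.1 * f p.2 * h (-(p.1 - p.2)) * K p.1 p.2 ∂(μ.prod μ) := by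
        rw [← Measure.measurePreserving_swap.lintegral_comp (by fun_prop)]
        exact lintegral_congr fun p => by simp only [Prod.fst_swap, Prod.snd_swap, neg_sub]; ring
    _ ≤ _ := lintegral_trilinear_kernel_fst_le hg hf hh' hK hS
    _ = _ := by rw [norm_eq]; ring

lemma lintegral_trilinear_kernel_sub_le (hf : Measurable f) (hg : Measurable g) (hh : Measurable h)
    (hK : Measurable K.uncurry) (hS : ∀ z, eLpNorm (K z) 2 μ ≤ S) :
    ∫⁻ p : G × G, f p.1 * g p.2 * h (p.1 - p.2) * K (p.1 - p.2) p.2 ∂(μ.prod μ) ≤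
      S * (eLpNorm f 2 μ * eLpNorm g 2 μ * eLpNorm h 2 μ) := by
  have hK' : Measurable fun p : G × G => K p.1 p.2 := hK
  have norm_eq : eLpNorm (fun p : G × G => f (p.1 + p.2) * g p.2) 2 (μ.prod μ) =
      eLpNorm f 2 μ * eLpNorm g 2 μ := by
    rw [← eLpNorm_two_prod_mul hf hg]
    have hm : Measurable fun q : G × G => f q.1 * g q.2 := by fun_prop
    exact (eLpNorm_comp_measurePreserving hm.aestronglyMeasurable
      (measurePreserving_add_prod μ μ) :)
  calc _ = ∫⁻ p : G × G, h p.1 * K p.1 p.2 * (f (p.1 + p.2) * g p.2) ∂(μ.prod μ) := by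
        rw [← (measurePreserving_sub_prod μ μ).lintegral_comp (f := fun p : G × G =>
          h p.1 * K p.1 p.2 * (f (p.1 + p.2) * g p.2)) (by fun_prop)]
        exact lintegral_congr fun p => by simp only [sub_add_cancel]; ring
    _ ≤ _ := lintegral_prod_kernel_mul_le hh hK (by fun_prop) hS
    _ = _ := by rw [norm_eq]; ring

lemma lintegral_mul_lintegral_mul_sub [μ.IsNegInvariant] (hf : Measurable f) (hg : Measurable g)
    (hh : Measurable h) :
    ∫⁻ x, f x * ∫⁻ y, g y * h (y - x) ∂μ ∂μ =
      ∫⁻ p : G × G, g p.1 * h p.2 * f (p.1 - p.2) ∂(μ.prod μ) := by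
  rw [lintegral_prod _ (by fun_prop)]
  calc ∫⁻ x, f x * ∫⁻ y, g y * h (y - x) ∂μ ∂μ = ∫⁻ x, ∫⁻ y, g y * h (y - x) * f x ∂μ ∂μ := by
        refine lintegral_congr fun x => ?_
        rw [mul_comm, lintegral_mul_const _ (by fun_prop)]
    _ = ∫⁻ y, ∫⁻ x, g y * h (y - x) * f x ∂μ ∂μ :=
        lintegral_lintegral_swap (Measurable.aemeasurable (by fun_prop))
    _ = ∫⁻ y, ∫⁻ x, g y * h x * f (y - x) ∂μ ∂μ := by
        refine lintegral_congr fun y => ?_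
        rw [← lintegral_sub_left_eq_self _ y]
        simp only [sub_sub_cancel]

end TrilinearKernel

section FreqMeasure

/-- The measure `(1/2π) ∑_k dτ` on the frequencies `(k, τ) ∈ ℤ × ℝ`, whose `L²` norm is the
`ℓ²_k L²_τ` norm. -/
noncomputable def freqMeasure : Measure (ℤ × ℝ) :=
  ((1 / (2 * Real.pi)).toNNReal • (Measure.count : Measure ℤ)).prod volume

instance : SigmaFinite freqMeasure := by
  unfold freqMeasure
  infer_instance

instance : freqMeasure.IsAddLeftInvariant := by
  unfold freqMeasure
  infer_instance

instance : freqMeasure.IsNegInvariant := by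
  have count_neg : MeasurePreserving (Neg.neg : ℤ → ℤ) Measure.count Measure.count :=
    Measure.measurePreserving_neg _
  exact ⟨((count_neg.smul_measure _).prod (Measure.measurePreserving_neg volume)).map_eq⟩

lemma lintegral_freqMeasure {f : ℤ × ℝ → ℝ≥0∞} (hf : Measurable f) :
    ∫⁻ x, f x ∂freqMeasure = ENNReal.ofReal (1 / (2 * Real.pi)) * ∑' k, ∫⁻ τ, f (k, τ) := by
  rw [freqMeasure, lintegral_prod _ hf.aemeasurable, lintegral_smul_measure, lintegral_count,
    ENNReal.smul_def, smul_eq_mul, ENNReal.ofReal]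

lemma ofReal_one_div_two_pi_le_one : ENNReal.ofReal (1 / (2 * Real.pi)) ≤ 1 := by
  rw [ENNReal.ofReal_le_one, div_le_one (by positivity)]
  linarith [Real.pi_gt_three]

lemma setLIntegral_freqMeasure_le (B : Finset ℤ) {f : ℤ × ℝ → ℝ≥0∞} (hf : Measurable f) :
    ∫⁻ x in Prod.fst ⁻¹' (B : Set ℤ), f x ∂freqMeasure ≤ ∑ k ∈ B, ∫⁻ τ, f (k, τ) := by
  have hB : MeasurableSet (Prod.fst ⁻¹' (B : Set ℤ) : Set (ℤ × ℝ)) :=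
    measurable_fst B.measurableSet
  rw [← lintegral_indicator hB, lintegral_freqMeasure (hf.indicator hB),
    tsum_eq_sum (s := B) fun k hk => by simp [hk]]
  refine (mul_le_of_le_one_left' ofReal_one_div_two_pi_le_one).trans (Finset.sum_le_sum ?_)
  exact fun k _ => lintegral_mono fun τ => Set.indicator_le_self _ _ _

end FreqMeasure

section Kernels

theorem exists_setLIntegral_weight_mul_weight_le {c : ℝ} (hc : 0 < c) :
    ∃ A : NNReal, ∀ (M : ℕ) (B : Finset ℤ) (a b : ℤ → ℝ), 1 ≤ M →
      (∀ k ∈ B, |(k : ℝ)| ≤ M) →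
      (∀ k ∈ B, ∀ j ∈ B, c * |(k - j : ℝ)| ≤ |(a k - b k) - (a j - b j)|) →
      ∫⁻ x in Prod.fst ⁻¹' (B : Set ℤ),
        weight (-(7 / 8)) (x.2 - a x.1) * weight (-(7 / 8)) (x.2 - b x.1) ∂freqMeasure ≤
          A * (M : ℝ≥0∞) ^ (1 / 2 : ℝ) := by
  obtain ⟨A, hA⟩ :=
    exists_sum_weight_le_of_separated hc (q := 5 / 8) (r := 9 / 8) (by norm_num) (by norm_num)
      (by norm_num)
  have hI := lintegral_weight_lt_top (r := 9 / 8) (by norm_num)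
  refine ⟨2 * (2 ^ (5 / 8 : ℝ) : ℝ).toNNReal * (∫⁻ x, weight (-(9 / 8)) x).toNNReal * A,
    fun M B a b hM hB hab => ?_⟩
  calc _ ≤ ∑ k ∈ B, ∫⁻ τ, weight (-(7 / 8)) (τ - a k) * weight (-(7 / 8)) (τ - b k) :=
        setLIntegral_freqMeasure_le B (by fun_prop)
    _ ≤ ∑ k ∈ B, 2 * ENNReal.ofReal (2 ^ (5 / 8 : ℝ)) * (∫⁻ x, weight (-(9 / 8)) x) *
          weight (-(5 / 8)) (a k - b k) := by
        gcongr with k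
        convert! lintegral_weight_mul_weight_le (p := 7 / 8) (q := 5 / 8) (by norm_num)
          (by norm_num) (a k) (b k) using 5
        norm_num
    _ ≤ 2 * ENNReal.ofReal (2 ^ (5 / 8 : ℝ)) * (∫⁻ x, weight (-(9 / 8)) x) *
          (A * (M : ℝ≥0∞) ^ (1 / 2 : ℝ)) := by
        rw [← Finset.mul_sum]
        gcongr
        convert! hA M B _ hM hB hab using 2
        norm_num
    _ = _ := by
        push_cast [ENNReal.coe_toNNReal hI.ne]
        simp only [ENNReal.ofReal]
        ring

/-- The frequencies with `|k| ≤ M`. -/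
noncomputable def lowFreq (M : ℕ) : Finset ℤ := Finset.Icc (-M) M

lemma mem_lowFreq {M : ℕ} {k : ℤ} : k ∈ lowFreq M ↔ |k| ≤ M := by
  rw [lowFreq, Finset.mem_Icc, abs_le]

lemma abs_le_of_mem_lowFreq {M : ℕ} {k : ℤ} (hk : k ∈ lowFreq M) : |(k : ℝ)| ≤ M := by
  exact_mod_cast mem_lowFreq.1 hk

variable (α β : ℝ) (M : ℕ)

/-- The kernel for an interaction in which the largest modulation is the Schrödinger modulation at
the frequency `x`; `y` is the other Schrödinger frequency. -/
noncomputable def waveKernel (x y : ℤ × ℝ) : ℝ≥0∞ :=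
  (Prod.fst ⁻¹' (lowFreq M : Set ℤ)).indicator
    (fun y => weight (-(7 / 16)) (modS α y) * weight (-(7 / 16)) (modW β (x - y))) y

/-- The kernel for an interaction in which the largest modulation is the wave modulation, at the
frequency `z`; the Schrödinger frequencies are `y + z` and `y`. -/
noncomputable def schrodingerKernel (z y : ℤ × ℝ) : ℝ≥0∞ :=
  if z.1 = 0 then 0 else (Prod.fst ⁻¹' (lowFreq M : Set ℤ)).indicator
    (fun y => weight (-(7 / 16)) (modS α (y + z)) * weight (-(7 / 16)) (modS α y)) y

lemma measurableSet_fst_mem_lowFreq : MeasurableSet {x : ℤ × ℝ | x.1 ∈ lowFreq M} :=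
  measurable_fst (lowFreq M).measurableSet

lemma measurable_waveKernel : Measurable (waveKernel α β M).uncurry := by
  have hm : Measurable fun p : (ℤ × ℝ) × (ℤ × ℝ) =>
      weight (-(7 / 16)) (modS α p.2) * weight (-(7 / 16)) (modW β (p.1 - p.2)) := by fun_prop
  exact hm.indicator (measurable_snd (measurableSet_fst_mem_lowFreq M))

lemma measurable_schrodingerKernel : Measurable (schrodingerKernel α M).uncurry := by
  have hm : Measurable fun p : (ℤ × ℝ) × (ℤ × ℝ) =>
      weight (-(7 / 16)) (modS α (p.2 + p.1)) * weight (-(7 / 16)) (modS α p.2) := by fun_prop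
  have hz : MeasurableSet {p : (ℤ × ℝ) × (ℤ × ℝ) | p.1.1 = 0} :=
    measurable_fst.fst (measurableSet_singleton 0)
  exact measurable_const.ite hz (hm.indicator (measurable_snd (measurableSet_fst_mem_lowFreq M)))

variable {α β M}

lemma waveKernel_of_mem {x y : ℤ × ℝ} (hy : y.1 ∈ lowFreq M) :
    waveKernel α β M x y = weight (-(7 / 16)) (modS α y) * weight (-(7 / 16)) (modW β (x - y)) :=
  Set.indicator_of_mem (s := Prod.fst ⁻¹' (lowFreq M : Set ℤ)) hy _

lemma schrodingerKernel_of_mem {z y : ℤ × ℝ} (hz : z.1 ≠ 0) (hy : y.1 ∈ lowFreq M) :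
    schrodingerKernel α M z y =
      weight (-(7 / 16)) (modS α (y + z)) * weight (-(7 / 16)) (modS α y) :=
  (if_neg hz).trans (Set.indicator_of_mem (s := Prod.fst ⁻¹' (lowFreq M : Set ℤ)) hy _)

lemma eLpNorm_two_indicator_weight_mul_weight_le {A : NNReal} {s : Set (ℤ × ℝ)}
    (hs : MeasurableSet s) {p q : ℤ × ℝ → ℝ}
    (h : ∫⁻ y in s, weight (-(7 / 8)) (p y) * weight (-(7 / 8)) (q y) ∂freqMeasure ≤
      A * (M : ℝ≥0∞) ^ (1 / 2 : ℝ)) :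
    eLpNorm (s.indicator fun y => weight (-(7 / 16)) (p y) * weight (-(7 / 16)) (q y)) 2
      freqMeasure ≤ NNReal.sqrt A * (M : ℝ≥0∞) ^ (1 / 4 : ℝ) := by
  rw [eLpNorm_indicator_eq_eLpNorm_restrict hs]
  refine eLpNorm_two_le_of_sq_le ?_
  rw [mul_pow, ← ENNReal.coe_pow, NNReal.sq_sqrt, ← ENNReal.rpow_mul_natCast]
  convert! h using 3
  · rw [mul_pow, weight_sq, weight_sq]
    norm_num
  · norm_num

lemma mul_abs_sub_le_abs_schrodinger_sub_wave {c s : ℝ} (hc : 0 ≤ c)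
    (gap : ∀ (n : ℤ) (s : ℝ), |s| = 1 → c * (1 + |(n : ℝ)|) ≤ |α * n - s * β|)
    (hs : |s| = 1) (x : ℤ × ℝ) (k j : ℤ) : c * |(k - j : ℝ)| ≤
      |(α * k ^ 2 - (x.2 - s * β * (x.1 - k))) - (α * j ^ 2 - (x.2 - s * β * (x.1 - j)))| := by
  have : (α * k ^ 2 - (x.2 - s * β * (x.1 - k))) - (α * j ^ 2 - (x.2 - s * β * (x.1 - j))) =
      (α * (k + j : ℤ) - s * β) * (k - j) := by push_cast; ring
  rw [this, abs_mul]
  gcongr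
  nlinarith [gap (k + j) s hs, abs_nonneg ((k + j : ℤ) : ℝ)]

theorem exists_eLpNorm_waveKernel_le (hβα : ∀ m : ℤ, β / α ≠ m) :
    ∃ A : NNReal, ∀ M : ℕ, 1 ≤ M → ∀ x,
      eLpNorm (waveKernel α β M x) 2 freqMeasure ≤ A * (M : ℝ≥0∞) ^ (1 / 4 : ℝ) := by
  obtain ⟨c, hc, gap⟩ := exists_le_abs_mul_sub_mul hβα
  obtain ⟨A, hA⟩ := exists_setLIntegral_weight_mul_weight_le hc
  refine ⟨NNReal.sqrt (2 * A), fun M hM x => eLpNorm_two_indicator_weight_mul_weight_le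
    (measurableSet_fst_mem_lowFreq M) ?_⟩
  calc ∫⁻ y in Prod.fst ⁻¹' (lowFreq M : Set ℤ),
        weight (-(7 / 8)) (modS α y) * weight (-(7 / 8)) (modW β (x - y)) ∂freqMeasure
      ≤ ∫⁻ y in Prod.fst ⁻¹' (lowFreq M : Set ℤ), ∑ s ∈ ({1, -1} : Finset ℝ),
          weight (-(7 / 8)) (y.2 - α * (y.1 : ℝ) ^ 2) *
            weight (-(7 / 8)) (y.2 - (x.2 - s * β * (x.1 - y.1))) ∂freqMeasure := by
        refine lintegral_mono fun y => ?_
        simp only [← Finset.mul_sum]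
        refine mul_le_mul_right ((weight_modW_le _ _ _).trans_eq ?_) _
        refine Finset.sum_congr rfl fun s _ => ?_
        rw [weight_sub_comm _ y.2, Prod.fst_sub, Prod.snd_sub]
        push_cast
        ring_nf
    _ = ∑ s ∈ ({1, -1} : Finset ℝ), ∫⁻ y in Prod.fst ⁻¹' (lowFreq M : Set ℤ),
          weight (-(7 / 8)) (y.2 - α * (y.1 : ℝ) ^ 2) *
            weight (-(7 / 8)) (y.2 - (x.2 - s * β * (x.1 - y.1))) ∂freqMeasure :=
        lintegral_finsetSum _ fun _ _ => by fun_prop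
    _ ≤ ∑ _s ∈ ({1, -1} : Finset ℝ), A * (M : ℝ≥0∞) ^ (1 / 2 : ℝ) := by
        gcongr with s hs
        have hs' : |s| = 1 := by
          rcases Finset.mem_insert.1 hs with rfl | hs
          · simp
          · simp [Finset.mem_singleton.1 hs]
        exact hA M _ (fun k => α * (k : ℝ) ^ 2) (fun k => x.2 - s * β * (x.1 - k)) hM
          (fun k => abs_le_of_mem_lowFreq) fun k _ j _ =>
            mul_abs_sub_le_abs_schrodinger_sub_wave hc.le gap hs' x k j
    _ = _ := by
        rw [Finset.sum_const, Finset.card_pair (by norm_num), nsmul_eq_mul]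
        push_cast
        ring

theorem exists_eLpNorm_schrodingerKernel_le (hα : α ≠ 0) :
    ∃ A : NNReal, ∀ M : ℕ, 1 ≤ M → ∀ z,
      eLpNorm (schrodingerKernel α M z) 2 freqMeasure ≤ A * (M : ℝ≥0∞) ^ (1 / 4 : ℝ) := by
  obtain ⟨A, hA⟩ := exists_setLIntegral_weight_mul_weight_le (abs_pos.2 hα)
  refine ⟨NNReal.sqrt A, fun M hM z => ?_⟩
  unfold schrodingerKernel
  split_ifs with hz
  · simp
  refine eLpNorm_two_indicator_weight_mul_weight_le (measurableSet_fst_mem_lowFreq M) ?_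
  have separated (k j : ℤ) : |α| * |(k - j : ℝ)| ≤
      |((α * (k + z.1) ^ 2 - z.2) - α * k ^ 2) - ((α * (j + z.1) ^ 2 - z.2) - α * j ^ 2)| := by
    have : ((α * (k + z.1) ^ 2 - z.2) - α * k ^ 2) - ((α * (j + z.1) ^ 2 - z.2) - α * j ^ 2) =
        α * (k - j) * (2 * z.1) := by ring
    have one_le : (1 : ℝ) ≤ |2 * (z.1 : ℝ)| := by
      have : (1 : ℝ) ≤ |(z.1 : ℝ)| := by exact_mod_cast Int.one_le_abs hz
      rw [abs_mul, abs_two]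
      linarith
    rw [this, abs_mul, abs_mul]
    exact le_mul_of_one_le_right (by positivity) one_le
  convert! hA M (lowFreq M) (fun k => α * (k + z.1) ^ 2 - z.2) (fun k => α * (k : ℝ) ^ 2) hM
    (fun k => abs_le_of_mem_lowFreq) (fun k _ j _ => separated k j) using 4 with y
  rw [modS, Prod.fst_add, Prod.snd_add]
  push_cast
  ring_nf

end Kernels

section TrilinearEstimate

variable {α β C : ℝ}

lemma rpow_mul_bracket_rpow_le {M m : ℝ} (hm : 1 ≤ |m|) (hM : |m| ≤ 2 * M) :
    M ^ (3 / 8 : ℝ) * bracket m ^ (1 / 2 : ℝ) ≤ 2 * (|m| * M) ^ (7 / 16 : ℝ) := by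
  have hb : bracket m ≤ 2 * |m| := bracket_le_two_mul_abs hm
  have hb0 := bracket_pos m
  have hM0 : 0 < M := by linarith
  have two_rpow : (4 : ℝ) ^ (1 / 16 : ℝ) * 2 ^ (7 / 16 : ℝ) ≤ 2 := by
    rw [show (4 : ℝ) = 2 ^ (2 : ℝ) by norm_num, ← Real.rpow_mul zero_le_two,
      ← Real.rpow_add two_pos]
    exact Real.rpow_le_self_of_one_le (by norm_num) (by norm_num)
  calc M ^ (3 / 8 : ℝ) * bracket m ^ (1 / 2 : ℝ)
      = M ^ (3 / 8 : ℝ) * (bracket m ^ (1 / 16 : ℝ) * bracket m ^ (7 / 16 : ℝ)) := by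
        rw [← Real.rpow_add hb0]
        norm_num
    _ ≤ M ^ (3 / 8 : ℝ) * ((4 * M) ^ (1 / 16 : ℝ) * (2 * |m|) ^ (7 / 16 : ℝ)) := by
        have : bracket m ≤ 4 * M := by linarith
        gcongr
    _ = 4 ^ (1 / 16 : ℝ) * 2 ^ (7 / 16 : ℝ) *
          (|m| ^ (7 / 16 : ℝ) * (M ^ (3 / 8 : ℝ) * M ^ (1 / 16 : ℝ))) := by
        rw [Real.mul_rpow (by positivity) hM0.le, Real.mul_rpow (by positivity) (by positivity)]
        ring
    _ = 4 ^ (1 / 16 : ℝ) * 2 ^ (7 / 16 : ℝ) * (|m| * M) ^ (7 / 16 : ℝ) := by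
        rw [← Real.rpow_add hM0, Real.mul_rpow (by positivity) hM0.le]
        norm_num
    _ ≤ 2 * (|m| * M) ^ (7 / 16 : ℝ) := by gcongr

lemma exists_rpow_mul_weight_le (hβα : ∀ m : ℤ, β / α ≠ m) (hC : 2 < C) :
    ∃ A : NNReal, ∀ (M : ℕ) (x y : ℤ × ℝ), (x.1, y.1) ∈ nonresonantPairs C M →
      (M : ℝ≥0∞) ^ (3 / 8 : ℝ) * weight (1 / 2) (x.1 - y.1) ≤
        A * (weight (7 / 16) (modS α x) + weight (7 / 16) (modS α y) +
          weight (7 / 16) (modW β (x - y))) := by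
  obtain ⟨c, hc, hmod⟩ := exists_le_bracket_add_bracket_add_bracket hβα hC
  refine ⟨(2 * c⁻¹ ^ (7 / 16 : ℝ)).toNNReal, fun M x y hxy => ?_⟩
  have h := hmod M x y hxy
  obtain ⟨hne, hx, hy, -⟩ := hxy
  have one_le : (1 : ℝ) ≤ |(x.1 - y.1 : ℝ)| := by
    exact_mod_cast Int.one_le_abs (sub_ne_zero.2 hne)
  have le_two_mul : |(x.1 - y.1 : ℝ)| ≤ 2 * M := by
    have hx' : |(x.1 : ℝ)| ≤ M := by exact_mod_cast hx
    have hy' : |(y.1 : ℝ)| ≤ M := by exact_mod_cast hy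
    linarith [abs_sub (x.1 : ℝ) y.1]
  calc (M : ℝ≥0∞) ^ (3 / 8 : ℝ) * weight (1 / 2) (x.1 - y.1)
      = ENNReal.ofReal ((M : ℝ) ^ (3 / 8 : ℝ) * bracket (x.1 - y.1) ^ (1 / 2 : ℝ)) := by
        rw [ENNReal.ofReal_mul (by positivity), ← weight,
          ← ENNReal.ofReal_rpow_of_nonneg M.cast_nonneg (by norm_num), ENNReal.ofReal_natCast]
    _ ≤ ENNReal.ofReal (2 * (c⁻¹ * (bracket (modS α x) + bracket (modS α y) +
          bracket (modW β (x - y)))) ^ (7 / 16 : ℝ)) := by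
        refine ENNReal.ofReal_le_ofReal ((rpow_mul_bracket_rpow_le one_le le_two_mul).trans ?_)
        have : |(x.1 - y.1 : ℝ)| * M ≤ c⁻¹ * (bracket (modS α x) + bracket (modS α y) +
            bracket (modW β (x - y))) := by rwa [← div_eq_inv_mul, le_div_iff₀' hc]
        gcongr
    _ = ENNReal.ofReal (2 * c⁻¹ ^ (7 / 16 : ℝ)) * (ENNReal.ofReal (bracket (modS α x)) +
          ENNReal.ofReal (bracket (modS α y)) +
            ENNReal.ofReal (bracket (modW β (x - y)))) ^ (7 / 16 : ℝ) := by
        have hS (z : ℤ × ℝ) := (bracket_pos (modS α z)).le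
        have hW := (bracket_pos (modW β (x - y))).le
        rw [Real.mul_rpow (by positivity) (add_nonneg (add_nonneg (hS x) (hS y)) hW), ← mul_assoc,
          ENNReal.ofReal_mul (by positivity), ← ENNReal.ofReal_add (hS x) (hS y),
          ← ENNReal.ofReal_add (add_nonneg (hS x) (hS y)) hW,
          ENNReal.ofReal_rpow_of_nonneg (add_nonneg (add_nonneg (hS x) (hS y)) hW) (by norm_num)]
    _ ≤ _ := by
        simp only [weight_eq_rpow]
        refine mul_le_mul_right ?_ _
        refine (ENNReal.rpow_add_le_add_rpow _ _ (by norm_num) (by norm_num)).trans ?_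
        gcongr
        exact ENNReal.rpow_add_le_add_rpow _ _ (by norm_num) (by norm_num)

lemma mul_mul_mul_weight_eq (f g h : ℤ × ℝ → ℝ≥0∞) {M : ℕ} {x y : ℤ × ℝ} (hxy : x.1 ≠ y.1)
    (hx : x.1 ∈ lowFreq M) (hy : y.1 ∈ lowFreq M) :
    f x * g y * h (x - y) * (weight (7 / 16) (modS α x) + weight (7 / 16) (modS α y) +
        weight (7 / 16) (modW β (x - y))) =
      weight (7 / 16) (modS α x) * f x * (weight (7 / 16) (modS α y) * g y) *
        (weight (7 / 16) (modW β (x - y)) * h (x - y)) *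
        (waveKernel α β M x y + waveKernel α β M y x + schrodingerKernel α M (x - y) y) := by
  have hz : (x - y).1 ≠ 0 := by rwa [Prod.fst_sub, sub_ne_zero]
  rw [waveKernel_of_mem hx, waveKernel_of_mem hy, schrodingerKernel_of_mem hz hy, ← neg_sub x y,
    modW_neg, add_sub_cancel]
  set wx := weight (7 / 16) (modS α x)
  set wy := weight (7 / 16) (modS α y)
  set wz := weight (7 / 16) (modW β (x - y))
  set vx := weight (-(7 / 16)) (modS α x)
  set vy := weight (-(7 / 16)) (modS α y)
  set vz := weight (-(7 / 16)) (modW β (x - y))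
  have hwx : wx * vx = 1 := weight_mul_weight_neg _ _
  have hwy : wy * vy = 1 := weight_mul_weight_neg _ _
  have hwz : wz * vz = 1 := weight_mul_weight_neg _ _
  calc f x * g y * h (x - y) * (wx + wy + wz)
      = f x * g y * h (x - y) * (wx * (wy * vy) * (wz * vz) + wx * vx * wy * (wz * vz) +
          wx * vx * (wy * vy) * wz) := by simp only [hwx, hwy, hwz, one_mul, mul_one]
    _ = _ := by ring

lemma exists_mul_mul_le (hβα : ∀ m : ℤ, β / α ≠ m) (hC : 2 < C) :
    ∃ A : NNReal, ∀ (M : ℕ) (f g h : ℤ × ℝ → ℝ≥0∞) (x y : ℤ × ℝ),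
      (f x * g y * h (x - y) ≠ 0 → (x.1, y.1) ∈ nonresonantPairs C M) →
      f x * g y * h (x - y) ≤ A * (M : ℝ≥0∞) ^ (-(3 / 8) : ℝ) *
        (weight (7 / 16) (modS α x) * f x * (weight (7 / 16) (modS α y) * g y) *
          (weight (7 / 16) (modW β (x - y)) * (weight (-(1 / 2)) (x - y).1 * h (x - y))) *
          (waveKernel α β M x y + waveKernel α β M y x + schrodingerKernel α M (x - y) y)) := by
  obtain ⟨A, hA⟩ := exists_rpow_mul_weight_le hβα hC
  refine ⟨A, fun M f g h x y hsupp => ?_⟩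
  by_cases hfgh : f x * g y * h (x - y) = 0
  · exact hfgh.trans_le zero_le
  have hxy := hsupp hfgh
  have hA' := hA M x y hxy
  obtain ⟨hne, hx, hy, -⟩ := hxy
  have hM : (M : ℝ≥0∞) ≠ 0 := by
    rintro hM
    rw [Nat.cast_eq_zero] at hM
    subst hM
    exact hne ((abs_nonpos_iff.1 hx).trans (abs_nonpos_iff.1 hy).symm)
  have M_cancel : (M : ℝ≥0∞) ^ (-(3 / 8) : ℝ) * (M : ℝ≥0∞) ^ (3 / 8 : ℝ) = 1 := by
    rw [← ENNReal.rpow_add _ _ hM (ENNReal.natCast_ne_top M)]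
    simp
  rw [← mul_mul_mul_weight_eq f g (fun z => weight (-(1 / 2)) z.1 * h z) hne (mem_lowFreq.2 hx)
    (mem_lowFreq.2 hy)]
  calc f x * g y * h (x - y)
      = (M : ℝ≥0∞) ^ (-(3 / 8) : ℝ) * ((M : ℝ≥0∞) ^ (3 / 8 : ℝ) * weight (1 / 2) (x - y).1) *
          (f x * g y * (weight (-(1 / 2)) (x - y).1 * h (x - y))) := by
        rw [← mul_assoc (_ ^ _), M_cancel, one_mul, mul_left_comm (f x * g y),
          ← mul_assoc (weight _ _) (weight _ _), weight_mul_weight_neg, one_mul]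
    _ ≤ (M : ℝ≥0∞) ^ (-(3 / 8) : ℝ) * (A * (weight (7 / 16) (modS α x) +
          weight (7 / 16) (modS α y) + weight (7 / 16) (modW β (x - y)))) *
          (f x * g y * (weight (-(1 / 2)) (x - y).1 * h (x - y))) := by
        rw [Prod.fst_sub, Int.cast_sub]
        exact mul_le_mul_left (mul_le_mul_right hA' _) _
    _ = _ := by ring

lemma exists_lintegral_mul_mul_kernel_le (hβα : ∀ m : ℤ, β / α ≠ m) :
    ∃ A : NNReal, ∀ M : ℕ, 1 ≤ M → ∀ f g h : ℤ × ℝ → ℝ≥0∞,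
      Measurable f → Measurable g → Measurable h →
      ∫⁻ p, f p.1 * g p.2 * h (p.1 - p.2) *
          (waveKernel α β M p.1 p.2 + waveKernel α β M p.2 p.1 +
            schrodingerKernel α M (p.1 - p.2) p.2) ∂(freqMeasure.prod freqMeasure) ≤
        A * (M : ℝ≥0∞) ^ (1 / 4 : ℝ) *
          (eLpNorm f 2 freqMeasure * eLpNorm g 2 freqMeasure * eLpNorm h 2 freqMeasure) := by
  have hα : α ≠ 0 := fun h => hβα 0 (by simp [h])
  obtain ⟨S, hS⟩ := exists_eLpNorm_waveKernel_le hβα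
  obtain ⟨T, hT⟩ := exists_eLpNorm_schrodingerKernel_le hα
  refine ⟨S + S + T, fun M hM f g h hf hg hh => ?_⟩
  have hwave := measurable_waveKernel α β M
  have hschr := measurable_schrodingerKernel α M
  have hsnd : Measurable fun p : (ℤ × ℝ) × (ℤ × ℝ) => waveKernel α β M p.2 p.1 :=
    hwave.comp measurable_swap
  simp only [mul_add]
  rw [lintegral_add_left (by fun_prop), lintegral_add_left (by fun_prop)]
  calc _ ≤ _ := add_le_add (add_le_add
        (lintegral_trilinear_kernel_fst_le hf hg hh hwave (hS M hM))
        (lintegral_trilinear_kernel_snd_le hf hg hh hwave (hS M hM)))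
        (lintegral_trilinear_kernel_sub_le hf hg hh hschr (hT M hM))
    _ = _ := by
        push_cast
        ring

theorem exists_lintegral_trilinear_le (hβα : ∀ m : ℤ, β / α ≠ m) (hC : 2 < C) :
    ∃ A : NNReal, ∀ M : ℕ, 1 ≤ M → ∀ f g h : ℤ × ℝ → ℝ≥0∞,
      Measurable f → Measurable g → Measurable h →
      (∀ x y, f x * g y * h (x - y) ≠ 0 → (x.1, y.1) ∈ nonresonantPairs C M) →
      ∫⁻ p, f p.1 * g p.2 * h (p.1 - p.2) ∂(freqMeasure.prod freqMeasure) ≤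
        A * (M : ℝ≥0∞) ^ (-(1 / 8) : ℝ) *
          (eLpNorm (fun x => weight (7 / 16) (modS α x) * f x) 2 freqMeasure *
            eLpNorm (fun x => weight (7 / 16) (modS α x) * g x) 2 freqMeasure *
            eLpNorm (fun x => weight (7 / 16) (modW β x) * (weight (-(1 / 2)) x.1 * h x)) 2
              freqMeasure) := by
  obtain ⟨R, hR⟩ := exists_mul_mul_le hβα hC
  obtain ⟨S, hS⟩ := exists_lintegral_mul_mul_kernel_le hβα
  refine ⟨R * S, fun M hM f g h hf hg hh hsupp => ?_⟩
  have hM0 : (M : ℝ≥0∞) ≠ 0 := by exact_mod_cast Nat.one_le_iff_ne_zero.1 hM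
  have M_mul : R * (M : ℝ≥0∞) ^ (-(3 / 8) : ℝ) * (S * (M : ℝ≥0∞) ^ (1 / 4 : ℝ)) =
      (R * S : NNReal) * (M : ℝ≥0∞) ^ (-(1 / 8) : ℝ) := by
    rw [show (-(1 / 8) : ℝ) = -(3 / 8) + 1 / 4 by norm_num,
      ENNReal.rpow_add _ _ hM0 (ENNReal.natCast_ne_top M), ENNReal.coe_mul]
    ring
  set F : ℤ × ℝ → ℝ≥0∞ := fun x => weight (7 / 16) (modS α x) * f x
  set G : ℤ × ℝ → ℝ≥0∞ := fun x => weight (7 / 16) (modS α x) * g x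
  set H : ℤ × ℝ → ℝ≥0∞ := fun x => weight (7 / 16) (modW β x) * (weight (-(1 / 2)) x.1 * h x)
  calc ∫⁻ p, f p.1 * g p.2 * h (p.1 - p.2) ∂(freqMeasure.prod freqMeasure)
      ≤ ∫⁻ p, R * (M : ℝ≥0∞) ^ (-(3 / 8) : ℝ) * (F p.1 * G p.2 * H (p.1 - p.2) *
          (waveKernel α β M p.1 p.2 + waveKernel α β M p.2 p.1 +
            schrodingerKernel α M (p.1 - p.2) p.2)) ∂(freqMeasure.prod freqMeasure) :=
        lintegral_mono fun p => hR M f g h p.1 p.2 (hsupp _ _)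
    _ ≤ R * (M : ℝ≥0∞) ^ (-(3 / 8) : ℝ) * (S * (M : ℝ≥0∞) ^ (1 / 4 : ℝ) *
          (eLpNorm F 2 freqMeasure * eLpNorm G 2 freqMeasure * eLpNorm H 2 freqMeasure)) := by
        rw [lintegral_const_mul' _ _ (ENNReal.mul_ne_top ENNReal.coe_ne_top
          (ENNReal.rpow_ne_top_of_ne_zero hM0 (ENNReal.natCast_ne_top M)))]
        gcongr
        exact hS M hM F G H (by fun_prop) (by fun_prop) (by fun_prop)
    _ = _ := by rw [← mul_assoc, M_mul]

end TrilinearEstimate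

section FourierProduct

local notation "L²" => Lp ℂ 2 (volume : Measure ℝ)

lemma schwartz_fourier_mul_eq (φ ψ : SchwartzMap ℝ ℂ) (ξ : ℝ) :
    𝓕 (fun t => φ t * ψ t) ξ = ∫ η, 𝓕 φ η * 𝓕 ψ (ξ - η) := by
  have h := SchwartzMap.convolution_apply (ContinuousLinearMap.mul ℂ ℂ) (𝓕⁻ φ) (𝓕⁻ ψ) (-ξ)
  simp only [SchwartzMap.convolution, LinearMap.coe_mk, AddHom.coe_mk,
    ContinuousLinearMap.comp_apply, FourierTransform.fourierCLM_apply,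
    FourierTransform.fourierInvCLM_apply, FourierTransform.fourier_fourierInv_eq,
    SchwartzMap.fourierInv_coe, Real.fourierInv_eq_fourier_neg, neg_neg,
    SchwartzMap.pairing_apply, convolution_def] at h
  rw [← integral_neg_eq_self] at h
  simpa [SchwartzMap.fourier_coe, Real.fourierInv_eq_fourier_neg, sub_eq_add_neg, add_comm]
    using! h

lemma coeFn_fourier_toLp (φ : SchwartzMap ℝ ℂ) :
    (𝓕 (φ.toLp 2 volume) : L²) =ᵐ[volume] (𝓕 φ : SchwartzMap ℝ ℂ) := by
  rw [SchwartzMap.toLp_fourier_eq]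
  exact SchwartzMap.coeFn_toLp _ _ volume

lemma continuous_fourier_mul (ξ : ℝ) :
    Continuous fun p : L² × L² => 𝓕 (fun t => p.1 t * p.2 t) ξ := by
  let mulL := ContinuousLinearMap.mul ℂ ℂ
  have eq_fourierL1 (p : L² × L²) : 𝓕 (fun t => p.1 t * p.2 t) ξ =
      Real.Lp.fourierTransformCLM ℝ ℂ (mulL.holderL volume 2 2 1 p.1 p.2) ξ :=
    Real.fourier_congr_ae (mulL.coeFn_holder p.1 p.2).symm ξ
  simp only [eq_fourierL1]
  fun_prop

lemma continuous_integral_fourier_mul_fourier (ξ : ℝ) :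
    Continuous fun p : L² × L² => ∫ η, (𝓕 p.1 : L²) η * (𝓕 p.2 : L²) (ξ - η) := by
  have hξ : MeasurePreserving (fun η : ℝ => ξ - η) := Measure.measurePreserving_sub_left volume ξ
  let mulL := ContinuousLinearMap.mul ℂ ℂ
  have eq_pairing (p : L² × L²) : ∫ η, (𝓕 p.1 : L²) η * (𝓕 p.2 : L²) (ξ - η) =
      mulL.lpPairing volume 2 2 (𝓕 p.1) (Lp.compMeasurePreservingₗᵢ ℂ _ hξ (𝓕 p.2)) := by
    rw [ContinuousLinearMap.lpPairing_eq_integral]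
    refine integral_congr_ae ?_
    filter_upwards [Lp.coeFn_compMeasurePreserving (𝓕 p.2 : L²) hξ] with η h
    exact congrArg _ h.symm
  simp only [eq_pairing]
  have : Continuous (𝓕 : L² → L²) := (Lp.fourierTransformₗᵢ ℝ ℂ).continuous
  fun_prop

theorem fourier_mul_eq_integral_fourier_mul (f g : L²) (ξ : ℝ) :
    𝓕 (fun t => f t * g t) ξ = ∫ η, (𝓕 f : L²) η * (𝓕 g : L²) (ξ - η) := by
  have dense := SchwartzMap.denseRange_toLpCLM (F := ℂ) (p := 2) (μ := (volume : Measure ℝ))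
    ENNReal.ofNat_ne_top
  refine dense.induction_on₂
    (p := fun f g : L² =>
      𝓕 (fun t => f t * g t) ξ = ∫ η, (𝓕 f : L²) η * (𝓕 g : L²) (ξ - η))
    (isClosed_eq (continuous_fourier_mul ξ) (continuous_integral_fourier_mul_fourier ξ))
    (fun φ ψ => ?_) f g
  simp only [SchwartzMap.toLpCLM_apply]
  have hξ : MeasurePreserving (fun η : ℝ => ξ - η) := Measure.measurePreserving_sub_left volume ξ
  calc
    _ = 𝓕 (fun t => φ t * ψ t) ξ := by
        rw [Real.fourier_eq, Real.fourier_eq]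
        refine integral_congr_ae ?_
        filter_upwards [φ.coeFn_toLp 2 volume, ψ.coeFn_toLp 2 volume] with t h₁ h₂
        rw [h₁, h₂]
    _ = _ := schwartz_fourier_mul_eq φ ψ ξ
    _ = _ := by
        refine integral_congr_ae ?_
        filter_upwards [coeFn_fourier_toLp φ,
          hξ.quasiMeasurePreserving.ae_eq_comp (coeFn_fourier_toLp ψ)] with η h₁ h₂
        exact congrArg₂ _ h₁.symm h₂.symm

theorem fourier_star_ae_eq (f : L²) :
    (𝓕 (star f) : L²) =ᵐ[volume] fun ξ => conj ((𝓕 f : L²) (-ξ)) := by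
  have neg_mp : MeasurePreserving (Neg.neg : ℝ → ℝ) := Measure.measurePreserving_neg volume
  have h : 𝓕 (star f) = star (Lp.compMeasurePreserving _ neg_mp (𝓕 f : L²)) := by
    refine ext_inner_right ℂ fun g => ?_
    obtain ⟨g, rfl⟩ := (Lp.fourierTransformₗᵢ ℝ ℂ).surjective g
    calc
      _ = inner ℂ (star f) g := Lp.inner_fourier_eq _ _
      _ = 𝓕 (fun t => g t * f t) 0 := by
          rw [L2.inner_def, Real.fourier_eq]
          refine integral_congr_ae ?_
          filter_upwards [Lp.coeFn_star f] with t ht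
          simp [ht]
      _ = ∫ η, (𝓕 g : L²) η * (𝓕 f : L²) (0 - η) := fourier_mul_eq_integral_fourier_mul g f 0
      _ = _ := by
          rw [L2.inner_def]
          refine integral_congr_ae ?_
          filter_upwards [Lp.coeFn_star (Lp.compMeasurePreserving _ neg_mp (𝓕 f : L²)),
            Lp.coeFn_compMeasurePreserving (𝓕 f : L²) neg_mp] with η h₁ h₂
          rw [h₁, Pi.star_apply, h₂]
          simp only [Function.comp_apply, zero_sub, RCLike.inner_apply, RCLike.star_def,
            RingHomCompTriple.comp_apply, RingHom.id_apply]
          rfl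
  rw [h]
  filter_upwards [Lp.coeFn_star (Lp.compMeasurePreserving _ neg_mp (𝓕 f : L²)),
    Lp.coeFn_compMeasurePreserving (𝓕 f : L²) neg_mp] with ξ h₁ h₂
  rw [h₁, Pi.star_apply, h₂]
  rfl

end FourierProduct

section SpatialCoeff

lemma spatialCoeff_one (k : ℤ) (t : ℝ) :
    spatialCoeff (fun _ _ => 1) k t = if k = 0 then 2 * (Real.pi : ℂ) else 0 := by
  split_ifs with hk
  · simp [spatialCoeff, hk]
  · have hne : -(Complex.I * k) ≠ 0 := by simpa using hk
    have h := integral_exp_mul_complex (a := 0) (b := 2 * Real.pi) hne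
    rw [show -(Complex.I * k) * ((2 * Real.pi : ℝ) : ℂ) =
      ((-k : ℤ) : ℂ) * (2 * Real.pi * Complex.I) by push_cast; ring,
      Complex.exp_int_mul_two_pi_mul_I] at h
    simpa [spatialCoeff] using h

lemma spatialCoeff_littlewoodPaley_mul (N : ℕ) (c : ℤ → ℝ → ℂ) {G : ℝ → ℝ → ℂ} (k : ℤ) {t : ℝ}
    (hG : Continuous (G t)) :
    spatialCoeff (fun t x => littlewoodPaley N c t x * G t x) k t =
      1 / (2 * Real.pi) * ∑ j ∈ block N, c j t * spatialCoeff G (k - j) t := by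
  have expand (x : ℝ) : Complex.exp (-(Complex.I * k * x)) * (littlewoodPaley N c t x * G t x) =
      1 / (2 * Real.pi) *
        ∑ j ∈ block N, c j t * (Complex.exp (-(Complex.I * ((k - j : ℤ) : ℂ) * x)) * G t x) := by
    simp only [littlewoodPaley, Finset.mul_sum, Finset.sum_mul]
    refine Finset.sum_congr rfl fun j _ => ?_
    rw [show -(Complex.I * ((k - j : ℤ) : ℂ) * x) = -(Complex.I * k * x) + Complex.I * j * x by
      push_cast; ring, Complex.exp_add]
    ring
  simp only [spatialCoeff, expand, intervalIntegral.integral_const_mul]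
  rw [intervalIntegral.integral_finsetSum fun j _ =>
    Continuous.intervalIntegrable (by fun_prop) _ _]
  simp only [intervalIntegral.integral_const_mul]

lemma spatialCoeff_littlewoodPaley (N : ℕ) (c : ℤ → ℝ → ℂ) (k : ℤ) (t : ℝ) :
    spatialCoeff (littlewoodPaley N c) k t = if k ∈ block N then c k t else 0 := by
  have h := spatialCoeff_littlewoodPaley_mul N c k (G := fun _ _ => 1) (t := t) continuous_const
  simp only [mul_one, spatialCoeff_one, sub_eq_zero, mul_ite, mul_zero, Finset.sum_ite_eq] at h
  rw [show littlewoodPaley N c = fun t x => littlewoodPaley N c t x from rfl, h]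
  have : (Real.pi : ℂ) ≠ 0 := Complex.ofReal_ne_zero.2 Real.pi_ne_zero
  split_ifs
  · field_simp
  · simp

lemma contDiff_littlewoodPaley (N : ℕ) (c : ℤ → ℝ → ℂ) (t : ℝ) :
    ContDiff ℝ 1 (littlewoodPaley N c t) := by
  unfold littlewoodPaley
  have : ContDiff ℝ 1 (fun x : ℝ => (x : ℂ)) := Complex.ofRealCLM.contDiff
  fun_prop

lemma periodic_littlewoodPaley (N : ℕ) (c : ℤ → ℝ → ℂ) (t : ℝ) :
    Function.Periodic (littlewoodPaley N c t) (2 * Real.pi) := by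
  intro x
  unfold littlewoodPaley
  congr! 3 with k
  rw [show Complex.I * k * ((x + 2 * Real.pi : ℝ) : ℂ) =
    Complex.I * k * x + k * (2 * Real.pi * Complex.I) by push_cast; ring]
  exact Complex.exp_periodic.int_mul k _

lemma spatialCoeff_deriv {F : ℝ → ℝ → ℂ} {t : ℝ} (smooth : ContDiff ℝ 1 (F t))
    (periodic : Function.Periodic (F t) (2 * Real.pi)) (k : ℤ) :
    spatialCoeff (fun t => deriv (F t)) k t = Complex.I * k * spatialCoeff F k t := by
  have exp_deriv (x : ℝ) : HasDerivAt (fun x : ℝ => Complex.exp (-(Complex.I * k * x)))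
      (Complex.exp (-(Complex.I * k * x)) * -(Complex.I * k)) x := by
    have := (Complex.ofRealCLM.hasDerivAt (x := x)).const_mul (Complex.I * k)
    simpa using this.fun_neg.cexp
  have parts := intervalIntegral.integral_mul_deriv_eq_deriv_mul (a := 0) (b := 2 * Real.pi)
    (fun x _ => exp_deriv x) (fun x _ => (smooth.differentiable one_ne_zero x).hasDerivAt)
    (Continuous.intervalIntegrable (by fun_prop) _ _)
    (Continuous.intervalIntegrable smooth.continuous_deriv_one _ _)
  have exp_two_pi : Complex.exp (-(Complex.I * k * ((2 * Real.pi : ℝ) : ℂ))) = 1 := by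
    rw [Complex.exp_eq_one_iff]
    exact ⟨-k, by push_cast; ring⟩
  have F_two_pi : F t (2 * Real.pi) = F t 0 := by simpa using periodic 0
  rw [spatialCoeff, parts, exp_two_pi, F_two_pi, spatialCoeff,
    ← intervalIntegral.integral_const_mul]
  simp only [Complex.ofReal_zero, mul_zero, neg_zero, Complex.exp_zero, sub_self, zero_sub]
  rw [← intervalIntegral.integral_neg]
  congr! 2 with x
  ring

end SpatialCoeff

section SpaceTimeFourier

lemma spaceTimeFourier_eq_fourier (F : ℝ → ℝ → ℂ) (k : ℤ) (τ : ℝ) :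
    spaceTimeFourier F k τ = 𝓕 (spatialCoeff F k) (τ / (2 * Real.pi)) := by
  rw [spaceTimeFourier, Real.fourier_real_eq_integral_exp_smul]
  congr! 3 with t
  have : (Real.pi : ℂ) ≠ 0 := Complex.ofReal_ne_zero.2 Real.pi_ne_zero
  push_cast
  field_simp

lemma spaceTimeFourier_littlewoodPaley (N : ℕ) (F : ℝ → ℝ → ℂ) (k : ℤ) (τ : ℝ) :
    spaceTimeFourier (littlewoodPaley N (spatialCoeff F)) k τ =
      if k ∈ block N then spaceTimeFourier F k τ else 0 := by
  simp only [spaceTimeFourier, spatialCoeff_littlewoodPaley]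
  split_ifs <;> simp

@[fun_prop]
lemma measurable_spaceTime_fourier (u : SpaceTime) (k : ℤ) : Measurable (u.fourier k) := by
  unfold SpaceTime.fourier
  exact (Lp.stronglyMeasurable _).measurable.comp (by fun_prop)

/-- The absolute value of the space-time Fourier transform of `P_N u`, as a function on the
frequencies `(k, τ)`. -/
noncomputable def blockFourier (N : ℕ) (u : SpaceTime) (x : ℤ × ℝ) : ℝ≥0∞ :=
  if x.1 ∈ block N then ‖u.fourier x.1 x.2‖ₑ else 0

@[fun_prop]
lemma measurable_blockFourier (N : ℕ) (u : SpaceTime) : Measurable (blockFourier N u) := by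
  refine measurable_from_prod_countable_right fun k => ?_
  by_cases hk : k ∈ block N <;> simp only [blockFourier, hk, if_true, if_false]
  · exact (measurable_spaceTime_fourier u k).enorm
  · exact measurable_const

lemma enorm_fourier_coeff_mul_coeff_le (u v : SpaceTime) (k l : ℤ) (τ : ℝ) :
    ‖𝓕 (fun t => u.coeff k t * v.coeff l t) (τ / (2 * Real.pi))‖ₑ ≤
      ENNReal.ofReal (2 * Real.pi)⁻¹ * ∫⁻ τ', ‖u.fourier k τ'‖ₑ * ‖v.fourier l (τ - τ')‖ₑ := by
  have rescale : 𝓕 (fun t => u.coeff k t * v.coeff l t) (τ / (2 * Real.pi)) =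
      ((2 * Real.pi)⁻¹ : ℝ) • ∫ τ', u.fourier k τ' * v.fourier l (τ - τ') := by
    simp only [SpaceTime.coeff, SpaceTime.fourier, sub_div]
    rw [fourier_mul_eq_integral_fourier_mul, Measure.integral_comp_div (fun η =>
      (𝓕 (u k) : Lp ℂ 2 volume) η * (𝓕 (v l) : Lp ℂ 2 volume) (τ / (2 * Real.pi) - η)),
      abs_of_pos Real.two_pi_pos, inv_smul_smul₀ Real.two_pi_pos.ne']
  rw [rescale, enorm_smul, Real.enorm_of_nonneg (by positivity)]
  gcongr
  refine (enorm_integral_le_lintegral_enorm _).trans_eq ?_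
  simp only [enorm_mul]

lemma enorm_spaceTimeFourier_mul_le (N₁ N₂ : ℕ) (u v : SpaceTime) (x : ℤ × ℝ) :
    ‖spaceTimeFourier (fun t x =>
        littlewoodPaley N₁ u.coeff t x * littlewoodPaley N₂ v.coeff t x) x.1 x.2‖ₑ ≤
      ∫⁻ y, blockFourier N₁ u y * blockFourier N₂ v (x - y) ∂freqMeasure := by
  have two_pi_inv_le : ENNReal.ofReal (2 * Real.pi)⁻¹ ≤ 1 := by
    simpa using ofReal_one_div_two_pi_le_one
  have integrable_mul (j l : ℤ) : Integrable fun t => u.coeff j t * v.coeff l t :=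
    (Lp.memLp (u j)).integrable_mul (Lp.memLp (v l))
  have sum_fourier : spaceTimeFourier (fun t x =>
        littlewoodPaley N₁ u.coeff t x * littlewoodPaley N₂ v.coeff t x) x.1 x.2 =
      1 / (2 * Real.pi) * ∑ j ∈ block N₁, if x.1 - j ∈ block N₂ then
        𝓕 (fun t => u.coeff j t * v.coeff (x.1 - j) t) (x.2 / (2 * Real.pi)) else 0 := by
    have coeff_mul (t : ℝ) := spatialCoeff_littlewoodPaley_mul N₁ u.coeff x.1
      (contDiff_littlewoodPaley N₂ v.coeff t).continuous
    simp only [spaceTimeFourier_eq_fourier, Real.fourier_eq, coeff_mul,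
      spatialCoeff_littlewoodPaley, ← mul_smul_comm, integral_const_mul, Finset.smul_sum]
    rw [integral_finsetSum]
    · congr! 2 with j _
      split_ifs <;> simp
    · intro j _
      simp only [mul_smul_comm]
      rw [Real.fourierIntegral_convergent_iff]
      split_ifs
      · exact integrable_mul j _
      · simp
  rw [sum_fourier, lintegral_freqMeasure (by fun_prop), enorm_mul]
  refine mul_le_mul' (le_of_eq ?_) ((enorm_sum_le _ _).trans ?_)
  · rw [← ofReal_norm]
    norm_num [abs_of_pos Real.pi_pos]
  refine (Finset.sum_le_sum fun j hj => ?_).trans (ENNReal.sum_le_tsum (block N₁))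
  split_ifs with hl
  · refine (enorm_fourier_coeff_mul_coeff_le u v j (x.1 - j) x.2).trans ?_
    refine (mul_le_of_le_one_left' two_pi_inv_le).trans_eq ?_
    simp [blockFourier, hj, hl]
  · simp

/-- The complex conjugate of a distribution, through its spatial Fourier coefficients. -/
noncomputable def spaceTimeConj (u : SpaceTime) : SpaceTime := fun k => star (u (-k))

lemma neg_mem_block {N : ℕ} {k : ℤ} : -k ∈ block N ↔ k ∈ block N := by
  simp [block]
  omega

lemma conj_littlewoodPaley_ae_eq (N : ℕ) (u : SpaceTime) : ∀ᵐ t, ∀ x,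
    conj (littlewoodPaley N u.coeff t x) = littlewoodPaley N (spaceTimeConj u).coeff t x := by
  have star_ae : ∀ᵐ t, ∀ k : ℤ, (spaceTimeConj u).coeff k t = conj (u.coeff (-k) t) :=
    ae_all_iff.2 fun k => Lp.coeFn_star (u (-k))
  filter_upwards [star_ae] with t ht x
  simp only [littlewoodPaley, map_mul, map_sum, ht, ← Complex.exp_conj]
  congr 1
  · simp [Complex.conj_ofNat]
  refine Finset.sum_nbij' Neg.neg Neg.neg ?_ ?_ (by simp) (by simp) (by simp)
  · exact fun k => neg_mem_block.2
  · exact fun k => neg_mem_block.2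

lemma fourier_spaceTimeConj_ae_eq (u : SpaceTime) (k : ℤ) :
    (spaceTimeConj u).fourier k =ᵐ[volume] fun τ => conj (u.fourier (-k) (-τ)) := by
  have qmp : Measure.QuasiMeasurePreserving (fun τ : ℝ => τ / (2 * Real.pi)) volume volume := by
    simp only [div_eq_inv_mul]
    exact Measure.quasiMeasurePreserving_smul volume (inv_ne_zero Real.two_pi_pos.ne')
  filter_upwards [qmp.ae (fourier_star_ae_eq (u (-k)))] with τ hτ
  rw [SpaceTime.fourier, SpaceTime.fourier, neg_div]
  exact hτ

lemma lintegral_mul_blockFourier_conj (N : ℕ) (u : SpaceTime) {f : ℤ × ℝ → ℝ≥0∞}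
    (hf : Measurable f) (x : ℤ × ℝ) :
    ∫⁻ y, f y * blockFourier N (spaceTimeConj u) (x - y) ∂freqMeasure =
      ∫⁻ y, f y * blockFourier N u (y - x) ∂freqMeasure := by
  rw [lintegral_freqMeasure (by fun_prop), lintegral_freqMeasure (by fun_prop)]
  congr! 3 with k
  refine lintegral_congr_ae ?_
  have mp : MeasurePreserving (fun τ : ℝ => x.2 - τ) :=
    Measure.measurePreserving_sub_left volume x.2
  filter_upwards [mp.quasiMeasurePreserving.ae (fourier_spaceTimeConj_ae_eq u (x.1 - k))]
    with τ hτ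
  have hblock : x.1 - k ∈ block N ↔ k - x.1 ∈ block N := by
    rw [← neg_mem_block, neg_sub]
  simp [blockFourier, hτ, hblock]

theorem enorm_spaceTimeFourier_schrodingerTerm_le (N₀ N₁ N₂ : ℕ) (u v : SpaceTime) (x : ℤ × ℝ) :
    ‖spaceTimeFourier (schrodingerTerm N₀ N₁ N₂ u v) x.1 x.2‖ₑ ≤
      (Prod.fst ⁻¹' (block N₀ : Set ℤ)).indicator (fun x =>
        ∫⁻ y, blockFourier N₁ u y * blockFourier N₂ v (x - y) ∂freqMeasure) x := by
  rw [schrodingerTerm, spaceTimeFourier_littlewoodPaley]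
  by_cases hx : x.1 ∈ block N₀
  · simpa [hx] using enorm_spaceTimeFourier_mul_le N₁ N₂ u v x
  · simp [hx]

theorem enorm_spaceTimeFourier_waveTerm_le (N₀ N₁ N₂ : ℕ) (u v : SpaceTime) (x : ℤ × ℝ) :
    ‖spaceTimeFourier (waveTerm N₀ N₁ N₂ u v) x.1 x.2‖ₑ ≤
      ENNReal.ofReal |(x.1 : ℝ)| * (Prod.fst ⁻¹' (block N₀ : Set ℤ)).indicator (fun x =>
        ∫⁻ y, blockFourier N₁ u y * blockFourier N₂ v (y - x) ∂freqMeasure) x := by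
  have fourier_deriv : spaceTimeFourier (fun t => deriv fun x =>
        littlewoodPaley N₁ u.coeff t x * conj (littlewoodPaley N₂ v.coeff t x)) x.1 x.2 =
      Complex.I * x.1 * spaceTimeFourier (fun t x => littlewoodPaley N₁ u.coeff t x *
        littlewoodPaley N₂ (spaceTimeConj v).coeff t x) x.1 x.2 := by
    rw [spaceTimeFourier, spaceTimeFourier, ← integral_const_mul]
    refine integral_congr_ae ?_
    filter_upwards [conj_littlewoodPaley_ae_eq N₂ v] with t conj_eq
    have coeff_deriv := spatialCoeff_deriv (F := fun t x => littlewoodPaley N₁ u.coeff t x *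
      littlewoodPaley N₂ (spaceTimeConj v).coeff t x) (t := t)
      ((contDiff_littlewoodPaley _ _ _).mul (contDiff_littlewoodPaley _ _ _))
      ((periodic_littlewoodPaley _ _ _).mul (periodic_littlewoodPaley _ _ _)) x.1
    simp only [spatialCoeff] at coeff_deriv ⊢
    simp only [conj_eq, coeff_deriv]
    ring
  rw [waveTerm, spaceTimeFourier_littlewoodPaley]
  by_cases hx : x.1 ∈ block N₀
  · simp only [hx, if_true, Set.indicator, Set.mem_preimage, Finset.mem_coe]
    rw [fourier_deriv, enorm_mul, ← lintegral_mul_blockFourier_conj N₂ v (by fun_prop)]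
    refine mul_le_mul' (le_of_eq ?_) (enorm_spaceTimeFourier_mul_le N₁ N₂ u (spaceTimeConj v) x)
    rw [← ofReal_norm, norm_mul, Complex.norm_I, one_mul, Complex.norm_intCast]
  · simp [hx]

end SpaceTimeFourier

section Norms

lemma enorm_ofReal_mul {r : ℝ} (hr : 0 ≤ r) (z : ℂ) :
    ‖(r : ℂ) * z‖ₑ = ENNReal.ofReal r * ‖z‖ₑ := by
  rw [enorm_mul, ← ofReal_norm, Complex.norm_of_nonneg hr]

lemma ell2_mono {a b : ℤ → ℝ≥0∞} (h : ∀ k, a k ≤ b k) : ell2 a ≤ ell2 b := by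
  unfold ell2
  gcongr with k
  exact h k

lemma ell2_sq (a : ℤ → ℝ≥0∞) :
    ell2 a ^ 2 = ENNReal.ofReal (1 / (2 * Real.pi)) * ∑' k, a k ^ 2 := by
  rw [ell2, ← ENNReal.rpow_natCast, ← ENNReal.rpow_mul]
  simp

lemma ell2_const_mul (c : ℝ≥0∞) (a : ℤ → ℝ≥0∞) : ell2 (fun k => c * a k) = c * ell2 a := by
  refine (ENNReal.pow_right_strictMono (n := 2) two_ne_zero).injective ?_
  simp only [mul_pow, ell2_sq, ENNReal.tsum_mul_left]
  ring

lemma ell2_eLpNorm_two {H : ℤ × ℝ → ℝ≥0∞} (hH : Measurable H) :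
    ell2 (fun k => eLpNorm (fun τ => H (k, τ)) 2 volume) = eLpNorm H 2 freqMeasure := by
  refine (ENNReal.pow_right_strictMono (n := 2) two_ne_zero).injective ?_
  simp only [ell2_sq, eLpNorm_two_sq]
  rw [lintegral_freqMeasure (by fun_prop)]

variable {m : ℤ × ℝ → ℝ} {r : ℤ → ℝ} {F : ℤ → ℝ → ℂ} {Φ : ℤ × ℝ → ℝ≥0∞}

lemma ell2_eLpNorm_two_mul_le (hm : Measurable m) (hr : ∀ k, 0 ≤ r k) (hΦ : Measurable Φ)
    (h : ∀ k τ, ENNReal.ofReal (r k) * ‖F k τ‖ₑ ≤ Φ (k, τ)) {a b : ℝ} (hab : a ≤ b) :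
    ell2 (fun k => eLpNorm
        (fun τ : ℝ => ((r k * bracket (m (k, τ)) ^ a : ℝ) : ℂ) * F k τ) 2 volume) ≤
      eLpNorm (fun x => weight b (m x) * Φ x) 2 freqMeasure := by
  rw [← ell2_eLpNorm_two (by fun_prop)]
  refine ell2_mono fun k => eLpNorm_mono_enorm fun τ => ?_
  rw [enorm_ofReal_mul (mul_nonneg (hr k) (bracket_rpow_nonneg _ _)),
    ENNReal.ofReal_mul (hr k), mul_right_comm, mul_comm, enorm_eq_self]
  exact mul_le_mul' (weight_mono hab _) (h k τ)

/- Cauchy–Schwarz in `τ` trades `⟨σ⟩⁻¹` for `⟨σ⟩^{b-1} ∈ L²_τ` times `⟨σ⟩^{-b}`. -/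
lemma ell2_eLpNorm_one_div_le (hm : Measurable m) (hr : ∀ k, 0 ≤ r k) (hΦ : Measurable Φ)
    (h : ∀ k τ, ENNReal.ofReal (r k) * ‖F k τ‖ₑ ≤ Φ (k, τ)) {b : ℝ} {I : ℝ≥0∞}
    (hI : ∀ k, eLpNorm (fun τ => weight (b - 1) (m (k, τ))) 2 volume ≤ I) :
    ell2 (fun k => eLpNorm
        (fun τ : ℝ => ((r k / bracket (m (k, τ)) : ℝ) : ℂ) * F k τ) 1 volume) ≤
      I * eLpNorm (fun x => weight (-b) (m x) * Φ x) 2 freqMeasure := by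
  rw [← ell2_eLpNorm_two (by fun_prop), ← ell2_const_mul]
  refine ell2_mono fun k => ?_
  rw [eLpNorm_one_eq_lintegral_enorm]
  calc ∫⁻ τ, ‖((r k / bracket (m (k, τ)) : ℝ) : ℂ) * F k τ‖ₑ
      ≤ ∫⁻ τ, weight (b - 1) (m (k, τ)) * (weight (-b) (m (k, τ)) * Φ (k, τ)) := by
        refine lintegral_mono fun τ => ?_
        have inv_eq : ENNReal.ofReal (bracket (m (k, τ)))⁻¹ =
            weight (b - 1) (m (k, τ)) * weight (-b) (m (k, τ)) := by
          rw [weight_mul_weight, weight, ← Real.rpow_neg_one]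
          ring_nf
        rw [enorm_ofReal_mul (div_nonneg (hr k) (bracket_pos _).le), div_eq_mul_inv,
          ENNReal.ofReal_mul (hr k), mul_right_comm, mul_comm, inv_eq, mul_assoc]
        exact mul_le_mul_right (mul_le_mul_right (h k τ) _) _
    _ ≤ eLpNorm (fun τ => weight (b - 1) (m (k, τ))) 2 volume *
        eLpNorm (fun τ => weight (-b) (m (k, τ)) * Φ (k, τ)) 2 volume :=
        lintegral_mul_le_eLpNorm_two (by fun_prop) (by fun_prop)
    _ ≤ I * eLpNorm (fun τ => weight (-b) (m (k, τ)) * Φ (k, τ)) 2 volume := by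
        gcongr
        exact hI k

lemma eLpNorm_two_weight_lt_top {r : ℝ} (hr : r < -(1 / 2)) : eLpNorm (weight r) 2 volume < ∞ := by
  refine (ENNReal.pow_lt_top_iff.1 ?_).resolve_right two_ne_zero
  simp only [eLpNorm_two_sq, weight_sq]
  simpa using lintegral_weight_lt_top (r := -(2 * r)) (by linarith)

lemma eLpNorm_two_weight_sub (r a : ℝ) :
    eLpNorm (fun τ => weight r (τ - a)) 2 volume = eLpNorm (weight r) 2 volume :=
  eLpNorm_comp_measurePreserving (measurable_weight r).aestronglyMeasurable
    (measurePreserving_sub_right volume a)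

lemma eLpNorm_two_weight_modS (α r : ℝ) (k : ℤ) :
    eLpNorm (fun τ => weight r (modS α (k, τ))) 2 volume = eLpNorm (weight r) 2 volume :=
  eLpNorm_two_weight_sub r (α * k ^ 2)

lemma eLpNorm_two_weight_modW_le (β r : ℝ) (k : ℤ) :
    eLpNorm (fun τ => weight r (modW β (k, τ))) 2 volume ≤ 2 * eLpNorm (weight r) 2 volume := by
  calc eLpNorm (fun τ => weight r (modW β (k, τ))) 2 volume
      ≤ eLpNorm (∑ s ∈ ({1, -1} : Finset ℝ), fun τ => weight r (τ - s * β * k)) 2 volume := by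
        refine eLpNorm_mono_enorm fun τ => ?_
        simpa only [Finset.sum_apply, enorm_eq_self] using weight_modW_le r β (k, τ)
    _ ≤ ∑ s ∈ ({1, -1} : Finset ℝ), eLpNorm (fun τ => weight r (τ - s * β * k)) 2 volume :=
        eLpNorm_sum_le
          (fun s _ => Measurable.aestronglyMeasurable (by fun_prop)) one_le_two
    _ = 2 * eLpNorm (weight r) 2 volume := by
        simp only [eLpNorm_two_weight_sub, Finset.sum_const, nsmul_eq_mul]
        norm_num [Finset.card_pair]

lemma normZS_le (hΦ : Measurable Φ) {α s : ℝ}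
    (h : ∀ (k : ℤ) (τ : ℝ), weight s k * ‖F k τ‖ₑ ≤ Φ (k, τ)) {b : ℝ} (hb : b ≤ 1 / 2) :
    normZS α s F ≤ (1 + eLpNorm (weight (b - 1)) 2 volume) *
      eLpNorm (fun x => weight (-b) (modS α x) * Φ x) 2 freqMeasure := by
  rw [add_mul, one_mul]
  exact add_le_add
    (ell2_eLpNorm_two_mul_le (measurable_modS α) (fun k => bracket_rpow_nonneg s k) hΦ h
      (by linarith))
    (ell2_eLpNorm_one_div_le (measurable_modS α) (fun k => bracket_rpow_nonneg s k) hΦ h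
      fun k => (eLpNorm_two_weight_modS α _ k).le)

lemma normZW_le (hΦ : Measurable Φ) {β s : ℝ}
    (h : ∀ (k : ℤ) (τ : ℝ), weight s k * ‖F k τ‖ₑ ≤ Φ (k, τ)) {b : ℝ} (hb : b ≤ 1 / 2) :
    normZW β s F ≤ (1 + 2 * eLpNorm (weight (b - 1)) 2 volume) *
      eLpNorm (fun x => weight (-b) (modW β x) * Φ x) 2 freqMeasure := by
  rw [add_mul, one_mul]
  exact add_le_add
    (ell2_eLpNorm_two_mul_le (measurable_modW β) (fun k => bracket_rpow_nonneg s k) hΦ h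
      (by linarith))
    (ell2_eLpNorm_one_div_le (measurable_modW β) (fun k => bracket_rpow_nonneg s k) hΦ h
      fun k => eLpNorm_two_weight_modW_le β _ k)

lemma le_ell2_eLpNorm_two_mul (hm : Measurable m) (hr : ∀ k, 0 ≤ r k) (hΦ : Measurable Φ)
    (h : ∀ k τ, Φ (k, τ) ≤ ENNReal.ofReal (r k) * ‖F k τ‖ₑ) {a b : ℝ} (hab : a ≤ b) :
    eLpNorm (fun x => weight a (m x) * Φ x) 2 freqMeasure ≤
      ell2 fun k => eLpNorm
        (fun τ : ℝ => ((r k * bracket (m (k, τ)) ^ b : ℝ) : ℂ) * F k τ) 2 volume := by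
  rw [← ell2_eLpNorm_two (by fun_prop)]
  refine ell2_mono fun k => eLpNorm_mono_enorm fun τ => ?_
  rw [enorm_ofReal_mul (mul_nonneg (hr k) (bracket_rpow_nonneg _ _)),
    ENNReal.ofReal_mul (hr k), mul_right_comm, mul_comm _ (ENNReal.ofReal (_ ^ b)), enorm_eq_self]
  exact mul_le_mul' (weight_mono hab _) (h k τ)

lemma blockFourier_le (N : ℕ) (u : SpaceTime) (x : ℤ × ℝ) :
    blockFourier N u x ≤ ‖u.fourier x.1 x.2‖ₑ := by
  unfold blockFourier
  split_ifs <;> simp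

lemma eLpNorm_blockFourier_le_normYS (α s : ℝ) {b : ℝ} (hb : b ≤ 1 / 2) (N : ℕ) (u : SpaceTime) :
    eLpNorm (fun x => weight b (modS α x) * (weight s x.1 * blockFourier N u x)) 2 freqMeasure ≤
      normYS α s u.fourier :=
  (le_ell2_eLpNorm_two_mul (measurable_modS α) (fun k => bracket_rpow_nonneg s k) (by fun_prop)
    (fun k τ => mul_le_mul_right (blockFourier_le N u (k, τ)) (weight s k)) hb).trans le_self_add

lemma eLpNorm_blockFourier_le_normYW (β s : ℝ) {b : ℝ} (hb : b ≤ 1 / 2) (N : ℕ) (u : SpaceTime) :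
    eLpNorm (fun x => weight b (modW β x) * (weight s x.1 * blockFourier N u x)) 2 freqMeasure ≤
      normYW β s u.fourier :=
  (le_ell2_eLpNorm_two_mul (measurable_modW β) (fun k => bracket_rpow_nonneg s k) (by fun_prop)
    (fun k τ => mul_le_mul_right (blockFourier_le N u (k, τ)) (weight s k)) hb).trans le_self_add

end Norms

section Blocks

lemma mem_block {N : ℕ} {k : ℤ} : k ∈ block N ↔ (N : ℤ) ≤ |k| ∧ |k| < 2 * N := by
  rw [block, Finset.mem_filter, Finset.mem_Ioo, abs_lt, and_comm]

lemma mem_nonresonantPairs_of_mem_block {C : ℝ} {N N₁ N₂ : ℕ} {k l : ℤ} (hk : k ∈ block N₁)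
    (hl : l ∈ block N₂) (hkl : k - l ∈ block N) (hnr : (k - l, k, l) ∈ nonresonantSet C) :
    (k, l) ∈ nonresonantPairs C (2 * max N₁ (max N₂ N)) := by
  rw [mem_block] at hk hl hkl
  refine ⟨?_, ?_, ?_, ?_, hnr⟩ <;> grind

variable {α β C : ℝ}

theorem exists_lintegral_block_trilinear_le (hβα : ∀ m : ℤ, β / α ≠ m) (hC : 2 < C) :
    ∃ A : NNReal, ∀ N₁ N₂ N : ℕ, 1 ≤ max N₁ (max N₂ N) →
      (∀ k ∈ block N₁, ∀ l ∈ block N₂, k - l ∈ block N → (k - l, k, l) ∈ nonresonantSet C) →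
      ∀ f g h : ℤ × ℝ → ℝ≥0∞, Measurable f → Measurable g → Measurable h →
        (∀ x, f x ≠ 0 → x.1 ∈ block N₁) → (∀ x, g x ≠ 0 → x.1 ∈ block N₂) →
        (∀ x, h x ≠ 0 → x.1 ∈ block N) →
        ∫⁻ p, f p.1 * g p.2 * h (p.1 - p.2) ∂(freqMeasure.prod freqMeasure) ≤
          A * ((max N₁ (max N₂ N) : ℕ) : ℝ≥0∞) ^ (-(1 / 8) : ℝ) *
            (eLpNorm (fun x => weight (7 / 16) (modS α x) * f x) 2 freqMeasure *
              eLpNorm (fun x => weight (7 / 16) (modS α x) * g x) 2 freqMeasure *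
              eLpNorm (fun x => weight (7 / 16) (modW β x) * (weight (-(1 / 2)) x.1 * h x)) 2
                freqMeasure) := by
  obtain ⟨A, hA⟩ := exists_lintegral_trilinear_le hβα hC
  refine ⟨A, fun N₁ N₂ N hN hnr f g h hf hg hh hf₁ hg₂ hhN => ?_⟩
  refine (hA (2 * max N₁ (max N₂ N)) (by lia) f g h hf hg hh fun x y hxy => ?_).trans ?_
  · rw [mul_ne_zero_iff, mul_ne_zero_iff] at hxy
    obtain ⟨⟨hfx, hgy⟩, hhxy⟩ := hxy
    have hkl : x.1 - y.1 ∈ block N := hhN _ hhxy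
    exact mem_nonresonantPairs_of_mem_block (hf₁ x hfx) (hg₂ y hgy) hkl
      (hnr _ (hf₁ x hfx) _ (hg₂ y hgy) hkl)
  · refine mul_le_mul_left (mul_le_mul_right ?_ _) _
    rw [ENNReal.rpow_neg, ENNReal.rpow_neg, ENNReal.inv_le_inv]
    exact ENNReal.rpow_le_rpow (by norm_cast; lia) (by norm_num)

end Blocks

section Estimates

variable {α β C : ℝ}

lemma mem_block_of_blockFourier_ne_zero {N : ℕ} {u : SpaceTime} {x : ℤ × ℝ}
    (h : blockFourier N u x ≠ 0) : x.1 ∈ block N := by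
  by_contra hx
  exact h (if_neg hx)

lemma measurableSet_fst_block (N : ℕ) :
    MeasurableSet (Prod.fst ⁻¹' (block N : Set ℤ) : Set (ℤ × ℝ)) :=
  measurable_fst (block N).measurableSet

lemma exists_eLpNorm_schrodinger_convolution_le (hβα : ∀ m : ℤ, β / α ≠ m) (hC : 2 < C) :
    ∃ A : NNReal, ∀ N₀ N₁ N₂ : ℕ, 1 ≤ max N₀ (max N₁ N₂) → NonresonantSum C N₀ N₁ N₂ →
      ∀ u v : SpaceTime,
        eLpNorm (fun x => weight (-(7 / 16)) (modS α x) *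
          (Prod.fst ⁻¹' (block N₀ : Set ℤ)).indicator (fun x =>
            ∫⁻ y, blockFourier N₁ u y * blockFourier N₂ v (x - y) ∂freqMeasure) x) 2 freqMeasure ≤
          A * ((max N₀ (max N₁ N₂) : ℕ) : ℝ≥0∞) ^ (-(1 / 8) : ℝ) *
            (normYS α 0 u.fourier * normYW β (-1 / 2) v.fourier) := by
  obtain ⟨A, hA⟩ := exists_lintegral_block_trilinear_le hβα hC
  refine ⟨A, fun N₀ N₁ N₂ hN hnr u v => ?_⟩
  refine eLpNorm_two_mul_indicator_le (measurableSet_fst_block N₀) (by fun_prop)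
    (fun x => weight_mul_weight_neg (7 / 16) (modS α x)) fun f hf hf₀ => ?_
  have hnr' : ∀ k₀ ∈ block N₀, ∀ k₁ ∈ block N₁, k₀ - k₁ ∈ block N₂ →
      (k₀ - k₁, k₀, k₁) ∈ nonresonantSet C := fun k₀ h₀ k₁ h₁ h₂ =>
    mem_nonresonantSet_rotate.1 (hnr k₀ h₀ k₁ h₁ _ h₂ (add_sub_cancel _ _).symm)
  set M : ℝ≥0∞ := ((max N₀ (max N₁ N₂) : ℕ) : ℝ≥0∞) ^ (-(1 / 8) : ℝ)
  set W : ℝ≥0∞ := eLpNorm (fun x => weight (7 / 16) (modS α x) * f x) 2 freqMeasure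
  have norm_u := eLpNorm_blockFourier_le_normYS α 0 (b := 7 / 16) (by norm_num) N₁ u
  have norm_v := eLpNorm_blockFourier_le_normYW β (-1 / 2) (b := 7 / 16) (by norm_num) N₂ v
  simp only [weight_zero, one_mul] at norm_u
  calc ∫⁻ x, f x * ∫⁻ y, blockFourier N₁ u y * blockFourier N₂ v (x - y) ∂freqMeasure ∂freqMeasure
      = ∫⁻ p, f p.1 * blockFourier N₁ u p.2 * blockFourier N₂ v (p.1 - p.2)
          ∂(freqMeasure.prod freqMeasure) := by
        rw [lintegral_prod _ (by fun_prop)]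
        refine lintegral_congr fun x => ?_
        simp only [mul_assoc]
        rw [lintegral_const_mul _ (by fun_prop)]
    _ ≤ A * M * (W * _ * _) :=
        hA N₀ N₁ N₂ hN hnr' f _ _ hf (by fun_prop) (by fun_prop) hf₀
          (fun _ => mem_block_of_blockFourier_ne_zero) fun _ => mem_block_of_blockFourier_ne_zero
    _ ≤ A * M * (W * normYS α 0 u.fourier * normYW β (-1 / 2) v.fourier) := by
        rw [← neg_div 2 1]
        exact mul_le_mul_right (mul_le_mul' (mul_le_mul_right norm_u _) norm_v) _
    _ = A * M * (normYS α 0 u.fourier * normYW β (-1 / 2) v.fourier) * W := by ring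

lemma exists_eLpNorm_wave_convolution_le (hβα : ∀ m : ℤ, β / α ≠ m) (hC : 2 < C) :
    ∃ A : NNReal, ∀ N₀ N₁ N₂ : ℕ, 1 ≤ max N₀ (max N₁ N₂) → NonresonantDiff C N₀ N₁ N₂ →
      ∀ u v : SpaceTime,
        eLpNorm (fun x => weight (-(7 / 16)) (modW β x) * weight (1 / 2) x.1 *
          (Prod.fst ⁻¹' (block N₀ : Set ℤ)).indicator (fun x =>
            ∫⁻ y, blockFourier N₁ u y * blockFourier N₂ v (y - x) ∂freqMeasure) x) 2 freqMeasure ≤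
          A * ((max N₀ (max N₁ N₂) : ℕ) : ℝ≥0∞) ^ (-(1 / 8) : ℝ) *
            (normYS α 0 u.fourier * normYS α 0 v.fourier) := by
  obtain ⟨A, hA⟩ := exists_lintegral_block_trilinear_le hβα hC
  refine ⟨A, fun N₀ N₁ N₂ hN hnr u v => ?_⟩
  refine eLpNorm_two_mul_indicator_le (measurableSet_fst_block N₀) (by fun_prop)
    (w := fun x => weight (7 / 16) (modW β x) * weight (-(1 / 2)) x.1) (fun x => ?_)
    fun f hf hf₀ => ?_
  · rw [mul_mul_mul_comm, weight_mul_weight_neg, one_mul, mul_comm, weight_mul_weight_neg]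
  have hnr' : ∀ k₁ ∈ block N₁, ∀ k₂ ∈ block N₂, k₁ - k₂ ∈ block N₀ →
      (k₁ - k₂, k₁, k₂) ∈ nonresonantSet C := fun k₁ h₁ k₂ h₂ h₀ => hnr _ h₀ k₁ h₁ k₂ h₂ rfl
  rw [max_comm, max_assoc] at hN ⊢
  set M : ℝ≥0∞ := ((max N₁ (max N₂ N₀) : ℕ) : ℝ≥0∞) ^ (-(1 / 8) : ℝ)
  set W : ℝ≥0∞ :=
    eLpNorm (fun x => weight (7 / 16) (modW β x) * weight (-(1 / 2)) x.1 * f x) 2 freqMeasure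
    with hW
  have norm_u := eLpNorm_blockFourier_le_normYS α 0 (b := 7 / 16) (by norm_num) N₁ u
  have norm_v := eLpNorm_blockFourier_le_normYS α 0 (b := 7 / 16) (by norm_num) N₂ v
  simp only [weight_zero, one_mul] at norm_u norm_v
  simp only [mul_assoc] at hW
  calc ∫⁻ x, f x * ∫⁻ y, blockFourier N₁ u y * blockFourier N₂ v (y - x) ∂freqMeasure ∂freqMeasure
      = ∫⁻ p, blockFourier N₁ u p.1 * blockFourier N₂ v p.2 * f (p.1 - p.2)
          ∂(freqMeasure.prod freqMeasure) :=
        lintegral_mul_lintegral_mul_sub hf (by fun_prop) (by fun_prop)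
    _ ≤ A * M * (_ * _ * W) := by
        rw [hW]
        exact hA N₁ N₂ N₀ hN hnr' _ _ f (by fun_prop) (by fun_prop) hf
          (fun _ => mem_block_of_blockFourier_ne_zero)
          (fun _ => mem_block_of_blockFourier_ne_zero) hf₀
    _ ≤ A * M * (normYS α 0 u.fourier * normYS α 0 v.fourier * W) :=
        mul_le_mul_right (mul_le_mul_left (mul_le_mul' norm_u norm_v) _) _
    _ = A * M * (normYS α 0 u.fourier * normYS α 0 v.fourier) * W := by ring

theorem exists_normZS_schrodingerTerm_le (hβα : ∀ m : ℤ, β / α ≠ m) (hC : 2 < C) :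
    ∃ K : NNReal, ∀ N₀ N₁ N₂ : ℕ, 1 ≤ max N₀ (max N₁ N₂) → NonresonantSum C N₀ N₁ N₂ →
      ∀ u v : SpaceTime, normZS α 0 (spaceTimeFourier (schrodingerTerm N₀ N₁ N₂ u v)) ≤
        K * ((max N₀ (max N₁ N₂) : ℕ) : ℝ≥0∞) ^ (-(1 / 8) : ℝ) *
          (normYS α 0 u.fourier * normYW β (-1 / 2) v.fourier) := by
  obtain ⟨A, hA⟩ := exists_eLpNorm_schrodinger_convolution_le hβα hC
  have weight_lt_top : 1 + eLpNorm (weight (7 / 16 - 1)) 2 volume < ⊤ :=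
    ENNReal.add_lt_top.2 ⟨ENNReal.one_lt_top, eLpNorm_two_weight_lt_top (by norm_num)⟩
  lift 1 + eLpNorm (weight (7 / 16 - 1)) 2 volume to NNReal using weight_lt_top.ne with B hB
  refine ⟨B * A, fun N₀ N₁ N₂ hN hnr u v => ?_⟩
  rw [ENNReal.coe_mul, mul_assoc, mul_assoc, ← mul_assoc (A : ℝ≥0∞), hB]
  refine (normZS_le (b := 7 / 16) ?_ (fun k τ => ?_) (by norm_num)).trans
    (mul_le_mul_right (hA N₀ N₁ N₂ hN hnr u v) _)
  · exact Measurable.indicator (by fun_prop) (measurableSet_fst_block N₀)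
  · rw [weight_zero, one_mul]
    exact enorm_spaceTimeFourier_schrodingerTerm_le N₀ N₁ N₂ u v (k, τ)

theorem exists_normZW_waveTerm_le (hβα : ∀ m : ℤ, β / α ≠ m) (hC : 2 < C) :
    ∃ K : NNReal, ∀ N₀ N₁ N₂ : ℕ, 1 ≤ max N₀ (max N₁ N₂) → NonresonantDiff C N₀ N₁ N₂ →
      ∀ u v : SpaceTime, normZW β (-1 / 2) (spaceTimeFourier (waveTerm N₀ N₁ N₂ u v)) ≤
        K * ((max N₀ (max N₁ N₂) : ℕ) : ℝ≥0∞) ^ (-(1 / 8) : ℝ) *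
          (normYS α 0 u.fourier * normYS α 0 v.fourier) := by
  obtain ⟨A, hA⟩ := exists_eLpNorm_wave_convolution_le hβα hC
  simp only [mul_assoc (weight _ (modW _ _))] at hA
  have weight_lt_top : 1 + 2 * eLpNorm (weight (7 / 16 - 1)) 2 volume < ⊤ :=
    ENNReal.add_lt_top.2 ⟨ENNReal.one_lt_top,
      ENNReal.mul_lt_top ENNReal.ofNat_lt_top (eLpNorm_two_weight_lt_top (by norm_num))⟩
  lift 1 + 2 * eLpNorm (weight (7 / 16 - 1)) 2 volume to NNReal using weight_lt_top.ne with B hB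
  refine ⟨B * A, fun N₀ N₁ N₂ hN hnr u v => ?_⟩
  rw [ENNReal.coe_mul, mul_assoc, mul_assoc, ← mul_assoc (A : ℝ≥0∞), hB]
  refine (normZW_le (b := 7 / 16) ?_ (fun k τ => ?_) (by norm_num)).trans
    (mul_le_mul_right (hA N₀ N₁ N₂ hN hnr u v) _)
  · exact Measurable.mul (by fun_prop)
      (Measurable.indicator (by fun_prop) (measurableSet_fst_block N₀))
  · refine (mul_le_mul_right
      (enorm_spaceTimeFourier_waveTerm_le N₀ N₁ N₂ u v (k, τ)) _).trans ?_
    rw [← mul_assoc]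
    exact mul_le_mul_left (weight_neg_half_mul_abs_le k) _

end Estimates

section Main

lemma coe_mul_natCast_rpow_le {K : NNReal} {L δ : ℝ} {n : ℕ} (hK : K ≤ L) (hn : 1 ≤ n)
    (hδ : δ ≤ 1 / 8) :
    K * (n : ℝ≥0∞) ^ (-(1 / 8) : ℝ) ≤ ENNReal.ofReal (L * (n : ℝ) ^ (-δ)) := by
  have hn' : (1 : ℝ) ≤ n := mod_cast hn
  rw [ENNReal.ofReal_mul (K.coe_nonneg.trans hK), ← ENNReal.ofReal_rpow_of_pos (by linarith),
    ENNReal.ofReal_natCast]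
  refine mul_le_mul' ?_ (ENNReal.rpow_le_rpow_of_exponent_le (mod_cast hn) (by linarith))
  rw [← ENNReal.ofReal_coe_nnreal]
  exact ENNReal.ofReal_le_ofReal hK

lemma IsDyadic.one_le {N : ℕ} (h : IsDyadic N) : 1 ≤ N := by
  obtain ⟨j, rfl⟩ := h
  exact Nat.one_le_two_pow

end Main

end Zakharov

theorem proposition4p2_general {α β C : ℝ} (hβα : ∀ m : ℤ, β / α ≠ m) (hC : 2 < C) :
    ∃ K : ℝ, 0 < K ∧ ∀ δ ≤ (1 / 8 : ℝ), ∀ N₀ N₁ N₂ : ℕ, 1 ≤ max N₀ (max N₁ N₂) →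
      (NonresonantSum C N₀ N₁ N₂ → ∀ u v : SpaceTime,
        normZS α 0 (spaceTimeFourier (schrodingerTerm N₀ N₁ N₂ u v)) ≤
          ENNReal.ofReal (K * ((max N₀ (max N₁ N₂) : ℕ) : ℝ) ^ (-δ)) *
            normYS α 0 u.fourier * normYW β (-1 / 2) v.fourier) ∧
      (NonresonantDiff C N₀ N₁ N₂ → ∀ u v : SpaceTime,
        normZW β (-1 / 2) (spaceTimeFourier (waveTerm N₀ N₁ N₂ u v)) ≤
          ENNReal.ofReal (K * ((max N₀ (max N₁ N₂) : ℕ) : ℝ) ^ (-δ)) *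
            normYS α 0 u.fourier * normYS α 0 v.fourier) := by
  obtain ⟨K₁, schrodinger_le⟩ := exists_normZS_schrodingerTerm_le hβα hC
  obtain ⟨K₂, wave_le⟩ := exists_normZW_waveTerm_le hβα hC
  have K₁_le : (K₁ : ℝ) ≤ K₁ + K₂ + 1 := by linarith [K₂.coe_nonneg]
  have K₂_le : (K₂ : ℝ) ≤ K₁ + K₂ + 1 := by linarith [K₁.coe_nonneg]
  refine ⟨K₁ + K₂ + 1, by positivity, fun δ hδ N₀ N₁ N₂ hN =>
    ⟨fun hnr u v => ?_, fun hnr u v => ?_⟩⟩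
  · rw [mul_assoc]
    exact (schrodinger_le N₀ N₁ N₂ hN hnr u v).trans
      (mul_le_mul_left (coe_mul_natCast_rpow_le K₁_le hN hδ) _)
  · rw [mul_assoc]
    exact (wave_le N₀ N₁ N₂ hN hnr u v).trans
      (mul_le_mul_left (coe_mul_natCast_rpow_le K₂_le hN hδ) _)

theorem proposition4p2 (α β : ℝ) (hα : 0 < α) (hβ : 0 < β) (hβα : ∀ m : ℤ, β / α ≠ (m : ℝ)) :
    ∃ δ₀ : ℝ, 0 < δ₀ ∧ ∀ C : ℝ, 2 < C → ∀ δ : ℝ, 0 < δ → δ ≤ δ₀ →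
      ∃ K : ℝ, 0 < K ∧ ∀ N₀ N₁ N₂ : ℕ, IsDyadic N₀ → IsDyadic N₁ → IsDyadic N₂ →
        (NonresonantSum C N₀ N₁ N₂ → ∀ u v : SpaceTime,
          normZS α 0 (spaceTimeFourier (schrodingerTerm N₀ N₁ N₂ u v)) ≤
            ENNReal.ofReal (K * ((max N₀ (max N₁ N₂) : ℕ) : ℝ) ^ (-δ)) *
              normYS α 0 u.fourier * normYW β (-1 / 2) v.fourier) ∧
        (NonresonantDiff C N₀ N₁ N₂ → ∀ u v : SpaceTime,
          normZW β (-1 / 2) (spaceTimeFourier (waveTerm N₀ N₁ N₂ u v)) ≤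
            ENNReal.ofReal (K * ((max N₀ (max N₁ N₂) : ℕ) : ℝ) ^ (-δ)) *
              normYS α 0 u.fourier * normYS α 0 v.fourier) := by
  refine ⟨1 / 8, by norm_num, fun C hC δ _ hδ => ?_⟩
  obtain ⟨K, hK, bounds⟩ := proposition4p2_general hβα hC
  exact ⟨K, hK, fun N₀ N₁ N₂ hN₀ _ _ => bounds δ hδ N₀ N₁ N₂ (le_max_of_le_left hN₀.one_le)⟩
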